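/- **Conventions.** Let $X$ be a finite abstract simplicial complex with geometric realization $|X|$ and let $x_0$ be a vertex of $X$. For a simplex $\sigma$ let $|\sigma|\subset|X|$ be its closed realization, with the Euclidean metric of the standard simplex. A *simplicial path* is a tuple $(v_0,\dots,v_k)$ of vertices such that every $\{v_i,v_{i+1}\}$ is a $1$-simplex; it defines a path in $|X|$. In $\pi_1(|X|,x_0)$ the product $[\Gamma][\Gamma']$ denotes the class of $\Gamma'$ followed by $\Gamma$. Fix a finite presentation $\pi_1(|X|,x_0)=\langle L\mid R\rangle$, i.e. a finite generating set $L\subset \pi_1(|X|,x_0)$ and a finite set $R\subset \mathrm{Fr}(L)$ whose normal closure is the kernel of $\mathrm{Fr}(L)\to\pi_1(|X|,x_0)$, and for every $g\in L$ a simplicial loop $\Gamma_g$ at $x_0$ representing $g$. For a C*-algebra $A$ and a Hilbert $A$-module $V$ let $U(\mathcal L_A(V))$ be the unitary group of the C*-algebra $\mathcal L_A(V)$ of adjointable operators, with the operator norm. An *$\epsilon$-almost representation* on $V$ is a homomorphism $\phi\colon\mathrm{Fr}(L)\to U(\mathcal L_A(V))$ with $\|\phi(r)-\mathrm{id}\|<\epsilon$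 for all $r\in R$. Homomorphisms $\phi,\psi\colon\mathrm{Fr}(L)\to U(\mathcal L_A(V))$ are *$\delta$-close* if $\|\phi(g)-\psi(g)\|\le\delta$ for all $g\in L$. Let $V$ be finitely generated projective, i.e. $V\cong pA^k$ for some $k$ and some projection $p\in\mathcal L_A(A^k)$. A *Hilbert $A$-module bundle* over $|X|$ with fibre $V$ is a fibre bundle $E\to|X|$ with typical fibre $V$ and structure group $U(\mathcal L_A(V))$ (norm topology); isomorphisms of such bundles are understood with respect to this structure group. An *$\epsilon$-flat bundle* ($\epsilon>0$) is such a bundle together with trivializations $\Phi_\sigma\colon|\sigma|\times V\to E|_{|\sigma|}$ for all simplices $\sigma$ of $X$, such that for all $\rho\subset\sigma$ the transition function $|\rho|\to U(\mathcal L_A(V))$, $x\mapsto\Phi_\rho(x,\cdot)^{-1}\Phi_\sigma(x,\cdot)$, is $\epsilon$-Lipschitz. *Transport* along an edge $\sigma=\{v,w\}$ is $T_{(v,w)}=\Phi_\sigma(w,\cdot)\Phi_\sigma(v,\cdot)^{-1}\colon E_v\to E_w$, and along a simplicial path it is $T_{(v_0,\dots,v_k)}=T_{(v_{k-1},v_k)}\cdots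 T_{(v_0,v_1)}$. Transport along the loops $\Gamma_g$ gives the homomorphism $\mathrm{Fr}(L)\to U(\mathcal L_A(V))$ with $g\mapsto\Phi_{\{x_0\}}(x_0,\cdot)^{-1}\,T_{\Gamma_g}\,\Phi_{\{x_0\}}(x_0,\cdot)$. **Theorem.** 1. There are constants $\delta,C>0$, depending only on $X$, $x_0$, the presentation and the loops $\Gamma_g$, such that for every C*-algebra $A$, every finitely generated projective Hilbert $A$-module $V$, every $0<\epsilon\le\delta$ and every $\epsilon$-almost representation $\phi\colon\mathrm{Fr}(L)\to U(\mathcal L_A(V))$ there is a $C\epsilon$-flat bundle $E\to|X|$ with fibre $V$ for which transport along the loops $\Gamma_g$ gives a $C\epsilon$-almost representation that is $C\epsilon$-close to $\phi$. 2. Suppose in addition that $X$ is connected, i.e. any two vertices of $X$ are joined by a simplicial path, and let $\Gamma'_g$ ($g\in L$) be a second choice of simplicial loops at $x_0$ representing the generators. Then there is a constant $\delta>0$, depending only on $X$, $x_0$, the presentation and the loops $\Gamma_g,\Gamma_g'$, such that for every C*-algebra $A$ and every finitely generated projective Hilbert $A$-module $V$ the following holds: if $E,E'\to|X|$ are $\delta$-flat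 bundles with fibre $V$ such that transport in $E$ along the loops $\Gamma_g$ and transport in $E'$ along the loops $\Gamma'_g$ are $\delta$-close, then $E$ and $E'$ are isomorphic Hilbert $A$-module bundles. -/

import Mathlib

/-! # Almost flat Hilbert module bundles over finite simplicial complexes -/

namespace AlmostFlat

/-! ## Hilbert modules

A Hilbert `A`-module is a `CStarModule A V` whose norm is complete.  Mathlib writes the scalars
on the left: `⟪x, a • y⟫ = a * ⟪x, y⟫`.  A right Hilbert `A`-module is the same thing as such a
module over the opposite C*-algebra; as `A` is always an arbitrary C*-algebra below, the two
conventions describe the same objects. -/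

section HilbertModules

variable (A : Type*)

/-- A (bijective, bicontinuous, linear) map is an isomorphism of Hilbert `A`-modules if it commutes
with the action of `A` and preserves the `A`-valued inner product.  Such a map is adjointable and
its adjoint is its inverse. -/
def IsHilbertIso {M N : Type*} [AddCommGroup M] [Module ℂ M] [TopologicalSpace M] [SMul A M]
    [Inner A M] [AddCommGroup N] [Module ℂ N] [TopologicalSpace N] [SMul A N] [Inner A N]
    (f : M ≃L[ℂ] N) : Prop :=
  (∀ (a : A) (m : M), f (a • m) = a • f m) ∧ ∀ m m' : M, inner A (f m) (f m') = inner A m m'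

section
variable {A}
variable {M N P : Type*} [AddCommGroup M] [Module ℂ M] [TopologicalSpace M] [SMul A M]
    [Inner A M] [AddCommGroup N] [Module ℂ N] [TopologicalSpace N] [SMul A N] [Inner A N]
    [AddCommGroup P] [Module ℂ P] [TopologicalSpace P] [SMul A P] [Inner A P]

theorem IsHilbertIso.refl : IsHilbertIso A (ContinuousLinearEquiv.refl ℂ M) :=
  ⟨fun _ _ => rfl, fun _ _ => rfl⟩

theorem IsHilbertIso.trans {f : M ≃L[ℂ] N} {g : N ≃L[ℂ] P} (hf : IsHilbertIso A f)
    (hg : IsHilbertIso A g) : IsHilbertIso A (f.trans g) :=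
  ⟨fun a m => by simp [hf.1, hg.1], fun m m' => by simp [hf.2, hg.2]⟩

theorem IsHilbertIso.symm {f : M ≃L[ℂ] N} (hf : IsHilbertIso A f) : IsHilbertIso A f.symm :=
  ⟨fun a n => f.injective (by simp [hf.1]), fun n n' => by
    rw [← hf.2]; simp⟩

end

/-- `U(𝓛_A(V))`: the unitary elements of the algebra of adjointable operators on `V`, i.e. the
automorphisms of the Hilbert `A`-module `V`. -/
def unitaryGroup (V : Type*) [AddCommGroup V] [Module ℂ V] [TopologicalSpace V] [SMul A V]
    [Inner A V] : Subgroup (V ≃L[ℂ] V) where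
  carrier := {u | IsHilbertIso A u}
  mul_mem' hu hv := hv.trans hu
  one_mem' := IsHilbertIso.refl
  inv_mem' hu := hu.symm

/-- The distance `‖u - v‖` in operator norm of two (bicontinuous) operators on `V`. -/
noncomputable def opDist {V : Type*} [NormedAddCommGroup V] [NormedSpace ℂ V]
    (u v : V ≃L[ℂ] V) : ℝ :=
  ‖(u : V →L[ℂ] V) - (v : V →L[ℂ] V)‖

open scoped WithCStarModule in
/-- `V` is isomorphic to `p Aᵏ` for some `k` and some projection `p = p² = p*` in `𝓛_A(Aᵏ)`. -/
def IsFGProjective [NonUnitalCStarAlgebra A] [PartialOrder A] [StarOrderedRing A]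
    (V : Type*) [NormedAddCommGroup V] [NormedSpace ℂ V] [SMul A V] [CStarModule A V] : Prop :=
  ∃ (k : ℕ) (p : C⋆ᵐᵒᵈ(A, Fin k → A) →L[ℂ] C⋆ᵐᵒᵈ(A, Fin k → A))
    (j : V →L[ℂ] C⋆ᵐᵒᵈ(A, Fin k → A)),
    (∀ x y, inner A (p x) y = inner A x (p y)) ∧ (∀ x, p (p x) = p x) ∧
    (∀ (a : A) (v : V), j (a • v) = a • j v) ∧ (∀ v w : V, inner A (j v) (j w) = inner A v w) ∧
    Set.range j = Set.range p

end HilbertModules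

/-! ## Finite simplicial complexes and their geometric realization -/

section Complexes

variable {ι : Type*} [Fintype ι] (X : AbstractSimplicialComplex ι)

/-- The geometric realization `|X|` of a complex with finite vertex set `ι`, with the topology
and the metric induced from Euclidean space `ℝ^ι`; on every `|σ|` this is the metric of the
standard simplex.  See `isOpen_iff_forall_cell` for the comparison with the weak topology. -/
def realization : Set (EuclideanSpace ℝ ι) :=
  {x | (∀ i, 0 ≤ x i) ∧ ∑ i, x i = 1 ∧ ∃ σ ∈ X.faces, ∀ i, x i ≠ 0 ↔ i ∈ σ}

/-- `|σ| ⊆ |X|`: the convex combinations of the vertices of `σ`. -/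
def cell (σ : Finset ι) : Set (realization X) :=
  {x | ∀ i, x.1 i ≠ 0 → i ∈ σ}

variable {X}

theorem cell_mono {ρ σ : Finset ι} (h : ρ ⊆ σ) : cell X ρ ⊆ cell X σ :=
  fun _ hx i hi => h (hx i hi)

theorem mem_realization {x : EuclideanSpace ℝ ι} {σ : Finset ι} (hσ : σ ∈ X.faces)
    (h0 : ∀ i, 0 ≤ x i) (h1 : ∑ i, x i = 1) (hx : ∀ i, x i ≠ 0 → i ∈ σ) :
    x ∈ realization X := by
  classical
  refine ⟨h0, h1, Finset.univ.filter (fun i => x i ≠ 0), ?_, by simp⟩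
  refine (X.isRelLowerSet_faces hσ).2 (fun i hi => hx i (by simpa using hi)) ?_
  by_contra hne
  rw [Finset.not_nonempty_iff_eq_empty, Finset.filter_eq_empty_iff] at hne
  have : ∑ i, x i = 0 := Finset.sum_eq_zero fun i hi => by simpa using hne hi
  rw [this] at h1
  exact zero_ne_one h1

/-- The topology of `|X|` is the weak topology: a set is open if and only if its trace on every
simplex `|σ|` is open in `|σ|`. -/
theorem isOpen_iff_forall_cell (U : Set (realization X)) :
    IsOpen U ↔ ∀ σ ∈ X.faces, IsOpen ((fun x : cell X σ => (x : realization X)) ⁻¹' U) := by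
  classical
  refine ⟨fun h σ _ => h.preimage continuous_subtype_val, fun h => ?_⟩
  have hclosed : ∀ σ : Finset ι, IsClosed (cell X σ) := fun σ => by
    have : cell X σ = ⋂ i ∈ {i | i ∉ σ}, {x : realization X | x.1 i = 0} := by
      ext x
      simp only [cell, Set.mem_ofPred_eq, Set.mem_iInter]
      exact forall_congr' fun i => ⟨fun H hi => not_not.1 fun h0 => hi (H h0),
        fun H h0 => not_not.1 fun hi => h0 (H hi)⟩
    rw [this]
    refine isClosed_biInter fun i _ => isClosed_eq ?_ continuous_const
    fun_prop
  rw [← isClosed_compl_iff]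
  have hU : Uᶜ = ⋃ σ ∈ X.faces, (fun x : cell X σ => (x : realization X)) ''
      ((fun x : cell X σ => (x : realization X)) ⁻¹' Uᶜ) := by
    ext x
    simp only [Set.mem_iUnion, Set.mem_image]
    constructor
    · intro hx
      obtain ⟨σ, hσ, hs⟩ := x.2.2.2
      exact ⟨σ, hσ, ⟨x, fun i => (hs i).1⟩, hx, rfl⟩
    · rintro ⟨σ, _, y, hy, rfl⟩
      exact hy
  rw [hU]
  refine (Set.toFinite X.faces).isClosed_biUnion fun σ hσ => ?_
  exact (hclosed σ).isClosedEmbedding_subtypeVal.isClosedMap _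
    (by rw [Set.preimage_compl, isClosed_compl_iff]; exact h σ hσ)

variable (X) [DecidableEq ι]

/-- The point of `|X|` given by a vertex. -/
noncomputable def vertex (v : ι) : realization X :=
  ⟨EuclideanSpace.single v 1, mem_realization (X.singleton_mem v)
    (fun i => by simp only [PiLp.single_apply]; split_ifs <;> simp)
    (by simp)
    (fun i hi => by
      simp only [PiLp.single_apply, ne_eq, ite_eq_right_iff, one_ne_zero,
        imp_false, not_not] at hi
      simpa using hi)⟩

variable {X} in
theorem vertex_mem_cell {v : ι} {σ : Finset ι} (h : v ∈ σ) : vertex X v ∈ cell X σ := by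
  intro i hi
  have : i = v := by
    by_contra hne
    exact hi (by simp [vertex, hne])
  exact this ▸ h

/-- The 1-skeleton of `X`, as a graph.  Its walks `(v₀, …, v_k)` are the simplicial paths. -/
def skeleton : SimpleGraph ι where
  Adj v w := v ≠ w ∧ ({v, w} : Finset ι) ∈ X.faces
  symm := ⟨fun v w h => ⟨h.1.symm, by rw [Finset.pair_comm]; exact h.2⟩⟩
  loopless := ⟨fun v h => h.1 rfl⟩

variable {X}

/-- The path `t ↦ (1 - t) v + t w` in `|X|` along an edge `{v, w}`. -/
noncomputable def edgePath {v w : ι} (h : (skeleton X).Adj v w) :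
    Path (vertex X v) (vertex X w) where
  toFun t := ⟨(1 - (t : ℝ)) • EuclideanSpace.single v 1 + (t : ℝ) • EuclideanSpace.single w 1,
    mem_realization h.2
      (fun i => by
        have h0 := t.2.1
        have h1 := sub_nonneg.2 t.2.2
        simp only [PiLp.add_apply, PiLp.smul_apply, PiLp.single_apply, smul_eq_mul]
        split_ifs <;> simp [h0, t.2.2])
      (by simp [Finset.sum_add_distrib])
      (fun i hi => by
        by_contra hne
        simp only [Finset.mem_insert, Finset.mem_singleton, not_or] at hne
        exact hi (by simp [hne.1, hne.2]))⟩
  continuous_toFun := by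
    refine Continuous.subtype_mk ?_ _
    fun_prop
  source' := by simp [vertex]
  target' := by simp [vertex]

/-- The path in `|X|` traversed by a simplicial path. -/
noncomputable def walkPath : ∀ {v w : ι}, (skeleton X).Walk v w → Path (vertex X v) (vertex X w)
  | _, _, .nil => Path.refl _
  | _, _, .cons h p => (edgePath h).trans (walkPath p)

/-- The element of `π₁(|X|, x₀)` represented by a simplicial loop at `x₀`.  In Mathlib's
fundamental group a product `p * q` is the class of the loop `q` followed by the loop `p`. -/
noncomputable def loopClass {x₀ : ι} (γ : (skeleton X).Walk x₀ x₀) :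
    FundamentalGroup (realization X) (vertex X x₀) :=
  FundamentalGroup.fromPath (Path.Homotopic.Quotient.mk (walkPath γ))

end Complexes

/-! ## Presentations and almost representations -/

section Presentations

/-- `G = ⟨L ∣ R⟩`: the set `L` generates `G`, and the kernel of the natural homomorphism from the
free group on `L` to `G` is the normal subgroup generated by `R`. -/
def IsPresentation {G : Type*} [Group G] (L : Set G) (R : Set (FreeGroup L)) : Prop :=
  Subgroup.closure L = ⊤ ∧
    (FreeGroup.lift (fun g : L => (g : G))).ker = Subgroup.normalClosure R

variable {A V : Type*} [NormedAddCommGroup V] [NormedSpace ℂ V] [SMul A V] [Inner A V]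

/-- `φ` is an `ε`-almost representation with respect to the relations `R`. -/
def IsAlmostRep {L : Type*} (R : Set (FreeGroup L)) (ε : ℝ)
    (φ : FreeGroup L →* unitaryGroup A V) : Prop :=
  ∀ r ∈ R, opDist (φ r : V ≃L[ℂ] V) (ContinuousLinearEquiv.refl ℂ V) < ε

/-- `φ` and `ψ` are `δ`-close on the generators. -/
def AreClose {L : Type*} (δ : ℝ) (φ ψ : FreeGroup L →* unitaryGroup A V) : Prop :=
  ∀ g : L, opDist (φ (FreeGroup.of g) : V ≃L[ℂ] V) (ψ (FreeGroup.of g)) ≤ δ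

end Presentations

/-! ## Hilbert module bundles -/

section Bundles

open Bundle

/-- A Hilbert `A`-module bundle over `B` with typical fibre `V` and structure group
`U(𝓛_A(V))` (with the norm topology): a complex vector bundle with fibre `V` (Mathlib's
`VectorBundle` asks that the coordinate changes be continuous in operator norm) whose fibres carry
an action of `A` and an `A`-valued inner product, such that the local trivializations are fibrewise
isomorphisms of Hilbert `A`-modules. -/
structure HilbertModuleBundle (A V B : Type*) [NormedAddCommGroup V]
    [NormedSpace ℂ V] [SMul A V] [Inner A V] [TopologicalSpace B] where
  Fiber : B → Type*
  [addCommGroup : ∀ b, AddCommGroup (Fiber b)]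
  [module : ∀ b, Module ℂ (Fiber b)]
  [smul : ∀ b, SMul A (Fiber b)]
  [inner : ∀ b, Inner A (Fiber b)]
  [topologicalSpaceFiber : ∀ b, TopologicalSpace (Fiber b)]
  [topologicalSpaceTotal : TopologicalSpace (TotalSpace V Fiber)]
  [fiberBundle : FiberBundle V Fiber]
  [vectorBundle : VectorBundle ℂ V Fiber]
  isHilbertIso : ∀ (e : Trivialization V (TotalSpace.proj : TotalSpace V Fiber → B))
    [MemTrivializationAtlas e] (b : B) (hb : b ∈ e.baseSet),
    IsHilbertIso A (e.continuousLinearEquivAt ℂ b hb)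

attribute [instance] HilbertModuleBundle.addCommGroup HilbertModuleBundle.module
  HilbertModuleBundle.smul HilbertModuleBundle.inner HilbertModuleBundle.topologicalSpaceFiber
  HilbertModuleBundle.topologicalSpaceTotal HilbertModuleBundle.fiberBundle
  HilbertModuleBundle.vectorBundle

variable {A V B : Type*} [NormedAddCommGroup V] [NormedSpace ℂ V]
  [SMul A V] [Inner A V] [TopologicalSpace B]

/-- Two bundles are isomorphic: there is a family of isomorphisms of Hilbert `A`-modules between
the fibres which is, in local trivializations, a continuous map into `U(𝓛_A(V))`. -/
def HilbertModuleBundle.Isomorphic (E E' : HilbertModuleBundle A V B) : Prop :=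
  ∃ Ξ : ∀ b, E.Fiber b ≃L[ℂ] E'.Fiber b, (∀ b, IsHilbertIso A (Ξ b)) ∧
    ∀ (e : Trivialization V (TotalSpace.proj : TotalSpace V E.Fiber → B))
      [MemTrivializationAtlas e]
      (e' : Trivialization V (TotalSpace.proj : TotalSpace V E'.Fiber → B))
      [MemTrivializationAtlas e'],
      ContinuousOn (fun b => (e'.continuousLinearMapAt ℂ b).comp
        ((Ξ b : E.Fiber b →L[ℂ] E'.Fiber b).comp (e.symmL ℂ b))) (e.baseSet ∩ e'.baseSet)

variable {ι : Type*} [Fintype ι] {X : AbstractSimplicialComplex ι}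

/-- A family of trivializations `Φ_σ : |σ| × V → E|_{|σ|}`, one over each simplex `σ` of `X`:
every `Φ_σ(x, ·)` is an isomorphism of Hilbert `A`-modules, and with respect to the local
trivializations of `E` it depends continuously on `x`, in operator norm. -/
structure TrivializationFamily (E : HilbertModuleBundle A V (realization X)) where
  Φ : ∀ (σ : X.faces) (x : cell X σ.1), V ≃L[ℂ] E.Fiber x.1
  isHilbertIso : ∀ (σ : X.faces) (x : cell X σ.1), IsHilbertIso A (Φ σ x)
  continuousOn : ∀ (σ : X.faces)
    (e : Trivialization V (TotalSpace.proj : TotalSpace V E.Fiber → realization X))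
    [MemTrivializationAtlas e],
    ContinuousOn (fun x : cell X σ.1 => (e.continuousLinearMapAt ℂ x.1).comp
      (Φ σ x : V →L[ℂ] E.Fiber x.1)) {x | x.1 ∈ e.baseSet}

namespace TrivializationFamily

variable {E : HilbertModuleBundle A V (realization X)} (T : TrivializationFamily E)

/-- The transition function `Ψ_{ρ ⊆ σ}(x) = Φ_ρ(x, ·)⁻¹ ∘ Φ_σ(x, ·)`, for `x ∈ |ρ|`. -/
def transition (ρ σ : X.faces) (h : ρ.1 ⊆ σ.1) (x : cell X ρ.1) : V ≃L[ℂ] V :=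
  (T.Φ σ ⟨x.1, cell_mono h x.2⟩).trans (T.Φ ρ x).symm

/-- The family is `ε`-flat: all transition functions are `ε`-Lipschitz. -/
def IsFlat (ε : ℝ) : Prop :=
  ∀ (ρ σ : X.faces) (h : ρ.1 ⊆ σ.1) (x y : cell X ρ.1),
    opDist (T.transition ρ σ h x) (T.transition ρ σ h y) ≤ ε * dist x y

variable [DecidableEq ι]

/-- `Φ_σ(v, ·)` at a vertex `v` of `σ`. -/
noncomputable def atVertex (σ : X.faces) (v : ι) (h : v ∈ σ.1) : V ≃L[ℂ] E.Fiber (vertex X v) :=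
  T.Φ σ ⟨vertex X v, vertex_mem_cell h⟩

theorem isHilbertIso_atVertex (σ : X.faces) (v : ι) (h : v ∈ σ.1) :
    IsHilbertIso A (T.atVertex σ v h) :=
  T.isHilbertIso σ ⟨vertex X v, vertex_mem_cell h⟩

/-- Transport along an edge, `T_{(v, w)} = Φ_σ(w, ·) ∘ Φ_σ(v, ·)⁻¹` where `σ = {v, w}`. -/
noncomputable def edgeTransport {v w : ι} (h : (skeleton X).Adj v w) :
    E.Fiber (vertex X v) ≃L[ℂ] E.Fiber (vertex X w) :=
  (T.atVertex ⟨{v, w}, h.2⟩ v (by simp)).symm.trans (T.atVertex ⟨{v, w}, h.2⟩ w (by simp))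

/-- Transport along a simplicial path, `T_{(v_{k-1}, v_k)} ∘ ⋯ ∘ T_{(v₀, v₁)}`. -/
noncomputable def transport : ∀ {v w : ι}, (skeleton X).Walk v w →
    (E.Fiber (vertex X v) ≃L[ℂ] E.Fiber (vertex X w))
  | _, _, .nil => ContinuousLinearEquiv.refl ℂ _
  | _, _, .cons h p => (T.edgeTransport h).trans (transport p)

theorem isHilbertIso_transport : ∀ {v w : ι} (p : (skeleton X).Walk v w),
    IsHilbertIso A (T.transport p)
  | _, _, .nil => IsHilbertIso.refl
  | _, _, .cons _ p =>
    ((T.isHilbertIso_atVertex _ _ _).symm.trans (T.isHilbertIso_atVertex _ _ _)).trans (isHilbertIso_transport p)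

/-- Transport along a simplicial loop at `x₀`, as an element of `U(𝓛_A(V))`; the fibre over `x₀`
is identified with `V` by the given trivialization `Φ_{x₀}` over the vertex `x₀`. -/
noncomputable def loopTransport {x₀ : ι} (γ : (skeleton X).Walk x₀ x₀) : unitaryGroup A V :=
  ⟨((T.atVertex ⟨{x₀}, X.singleton_mem x₀⟩ x₀ (by simp)).trans (T.transport γ)).trans
      (T.atVertex ⟨{x₀}, X.singleton_mem x₀⟩ x₀ (by simp)).symm,
    ((T.isHilbertIso_atVertex _ _ _).trans (T.isHilbertIso_transport γ)).trans (T.isHilbertIso_atVertex _ _ _).symm⟩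

/-- The homomorphism `Fr(L) → U(𝓛_A(V))` given by transport along the loops `Γ_g`, `g ∈ L`. -/
noncomputable def transportRep {L : Type*} {x₀ : ι} (Γ : L → (skeleton X).Walk x₀ x₀) :
    FreeGroup L →* unitaryGroup A V :=
  FreeGroup.lift fun g => T.loopTransport (Γ g)

end TrivializationFamily

end Bundles

end AlmostFlat

open AlmostFlat

universe u₀ u v w w₁

/-! Up to bounded errors, an almost flat bundle is an almost cocycle: unitaries on the edges that
multiply correctly on every simplex up to ε. Both halves pass through this notion. The comparison
constants rest on one principle. An element of a normal closure is a product of a fixed number of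
conjugates of relators and their inverses, and ‖φ(x) - 1‖ is a conjugation-invariant length, so that
number bounds the error for all A and V at once (`exists_norm_op_sub_one_le`).

Existence. Paths from x₀ to the vertices of its component turn edges into elements of π₁, which form
an exact cocycle (`exists_edgeClass`). Words for these elements, evaluated by φ, form an almost
cocycle. `IsAlmostCocycle.exists_isCocycleOn` moves it to an exact cocycle of Lipschitz functions,
adding one vertex at a time: interpolate linearly between the new vertex and the opposite face, then
return to the unitaries by polar decomposition. This cocycle glues a bundle over the open stars of
the vertices, and its edge transports stay close to the almost cocycle, hence its holonomy close to
φ.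

Uniqueness. Edge transports of a flat bundle form an almost cocycle. For an exact cocycle, the
product along a loop depends only on the homotopy class of the loop, being a monodromy of a covering
(`IsCocycle.walkProd_eq`). Applied to the universal cocycle, this shows that the transport along any
loop is determined up to bounded error by those along generating loops
(`exists_norm_walkProd_sub_lift_le`). So if the holonomies are close, transport out to a vertex in
E' after transport back to x₀ in E approximately intertwines all edge transports. These unitaries
spread to local isomorphisms, which a partition of unity averages and polar decomposition makes
unitary (`isomorphic_of_intertwining`). -/

namespace AlmostFlat

set_option linter.unusedSectionVars false

/-! ### The power series of the inverse square root in a Banach algebra. -/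

section InvSqrt

/-- The coefficients of the power series of `(1 + x) ^ (-1/2)`. -/
noncomputable def invSqrtCoeff (n : ℕ) : ℝ := Ring.choose (-1 / 2 : ℝ) n

theorem invSqrtCoeff_zero : invSqrtCoeff 0 = 1 := Ring.choose_zero_right _

/-- Consecutive coefficients have ratio -(n + 1/2) / (n + 1), of absolute value below 1. -/
theorem abs_invSqrtCoeff_le_one (n : ℕ) : |invSqrtCoeff n| ≤ 1 := by
  induction n with
  | zero => simp [invSqrtCoeff]
  | succ n ih =>
    have h : ((n : ℝ) + 1) * invSqrtCoeff (n + 1) = invSqrtCoeff n * (-1 / 2 - n) := by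
      have := Ring.choose_smul_choose (-1 / 2 : ℝ) (Nat.le_succ n)
      simp only [Nat.succ_eq_add_one, Nat.choose_succ_self_right, nsmul_eq_mul,
        Nat.add_sub_cancel_left, Ring.choose_one_right] at this
      simpa [invSqrtCoeff] using this
    have h1 : ((n : ℝ) + 1) * |invSqrtCoeff (n + 1)| = |invSqrtCoeff n| * (1 / 2 + n) := by
      have h0 : |(n : ℝ) + 1| = n + 1 := abs_of_pos (by positivity)
      have h3 := congrArg abs h
      rw [abs_mul, abs_mul, h0] at h3
      rw [h3]
      congr 1
      rw [abs_of_nonpos (by linarith [(Nat.cast_nonneg n : (0 : ℝ) ≤ n)])]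
      ring
    have h2 : (0 : ℝ) < n + 1 := by positivity
    by_contra! h3
    nlinarith [abs_nonneg (invSqrtCoeff n)]

/-- Vandermonde's identity for the exponents -1/2 and -1/2: the square of the series of (1 + x) ^
(-1/2) is the series of (1 + x)⁻¹. -/
theorem sum_antidiagonal_invSqrtCoeff (n : ℕ) :
    ∑ p ∈ Finset.HasAntidiagonal.antidiagonal n, invSqrtCoeff p.1 * invSqrtCoeff p.2 =
      (-1) ^ n := by
  have h := Ring.add_choose_eq n (Commute.all (-1 / 2 : ℝ) (-1 / 2))
  have h1 : (-1 / 2 : ℝ) + -1 / 2 = -((1 : ℕ) : ℝ) := by norm_num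
  rw [h1, Ring.choose_neg] at h
  have h2 : ((1 : ℕ) : ℝ) + n - 1 = (n : ℕ) := by simp
  rw [h2, Ring.choose_natCast, Nat.choose_self] at h
  simp only [invSqrtCoeff]
  rw [← h]
  simp [Units.smul_def]

variable {B : Type*} [NormedRing B]

/-- Assuming ‖1‖ ≤ 1 instead of ‖1‖ = 1 admits operators on the zero module. -/
theorem norm_pow_le_of_norm_le_half (h1 : ‖(1 : B)‖ ≤ 1) {x : B} (hx : ‖x‖ ≤ 1 / 2) (n : ℕ) :
    ‖x ^ n‖ ≤ (1 / 2) ^ n := by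
  induction n with
  | zero => simpa using h1
  | succ n ih =>
    rw [pow_succ, pow_succ]
    exact (norm_mul_le _ _).trans (mul_le_mul ih hx (norm_nonneg _) (by positivity))

/-- The factor is n (1/2) ^ (n - 1), the Lipschitz constant of the n-th power on the ball of radius
1/2, written without truncated subtraction. -/
theorem norm_pow_sub_pow_le_of_norm_le_half (h1 : ‖(1 : B)‖ ≤ 1) {x y : B} (hx : ‖x‖ ≤ 1 / 2)
    (hy : ‖y‖ ≤ 1 / 2) (n : ℕ) :
    ‖x ^ n - y ^ n‖ ≤ 2 * (n * (1 / 2) ^ n) * ‖x - y‖ := by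
  induction n with
  | zero => simp
  | succ n ih =>
    have h : x ^ (n + 1) - y ^ (n + 1) = (x ^ n - y ^ n) * x + y ^ n * (x - y) := by
      rw [pow_succ, pow_succ]; noncomm_ring
    calc ‖x ^ (n + 1) - y ^ (n + 1)‖
        ≤ 2 * (n * (1 / 2) ^ n) * ‖x - y‖ * (1 / 2) + (1 / 2) ^ n * ‖x - y‖ := by
          rw [h]
          refine (norm_add_le _ _).trans (add_le_add ?_ ?_)
          · exact (norm_mul_le _ _).trans (mul_le_mul ih hx (norm_nonneg _) (by positivity))
          · exact (norm_mul_le _ _).trans (mul_le_mul_of_nonneg_right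
              (norm_pow_le_of_norm_le_half h1 hy n) (norm_nonneg _))
      _ = 2 * (((n + 1 : ℕ) : ℝ) * (1 / 2) ^ (n + 1)) * ‖x - y‖ := by push_cast; ring

variable [NormedAlgebra ℝ B]

/-- The inverse square root `b ^ (-1/2)` of an element near `1`. -/
noncomputable def invSqrt (b : B) : B := ∑' n, invSqrtCoeff n • (b - 1) ^ n

theorem norm_invSqrtCoeff_smul_le (n : ℕ) (b : B) : ‖invSqrtCoeff n • b‖ ≤ ‖b‖ := by
  rw [norm_smul, Real.norm_eq_abs]
  exact mul_le_of_le_one_left (norm_nonneg _) (abs_invSqrtCoeff_le_one n)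

theorem summable_norm_invSqrt (h1 : ‖(1 : B)‖ ≤ 1) {b : B} (hb : ‖b - 1‖ ≤ 1 / 2) :
    Summable fun n => ‖invSqrtCoeff n • (b - 1) ^ n‖ :=
  Summable.of_nonneg_of_le (fun _ => norm_nonneg _)
    (fun n => (norm_invSqrtCoeff_smul_le n _).trans (norm_pow_le_of_norm_le_half h1 hb n))
    (summable_geometric_of_lt_one (by norm_num) (by norm_num))

theorem invSqrt_one : invSqrt (1 : B) = 1 := by
  rw [invSqrt, tsum_eq_single 0]
  · simp [invSqrtCoeff_zero]
  · intro n hn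
    simp [hn]

theorem norm_invSqrt_le (h1 : ‖(1 : B)‖ ≤ 1) {b : B} (hb : ‖b - 1‖ ≤ 1 / 2) :
    ‖invSqrt b‖ ≤ 2 := by
  refine tsum_of_norm_bounded (hasSum_geometric_two) fun n => ?_
  exact (norm_invSqrtCoeff_smul_le n _).trans (norm_pow_le_of_norm_le_half h1 hb n)

variable [CompleteSpace B]

theorem hasSum_invSqrt (h1 : ‖(1 : B)‖ ≤ 1) {b : B} (hb : ‖b - 1‖ ≤ 1 / 2) :
    HasSum (fun n => invSqrtCoeff n • (b - 1) ^ n) (invSqrt b) :=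
  (summable_norm_invSqrt h1 hb).of_norm.hasSum

/-- The constant 4 is the sum of the Lipschitz constants 2 n (1/2) ^ n of the powers. -/
theorem norm_invSqrt_sub_le (h1 : ‖(1 : B)‖ ≤ 1) {a b : B} (ha : ‖a - 1‖ ≤ 1 / 2)
    (hb : ‖b - 1‖ ≤ 1 / 2) : ‖invSqrt a - invSqrt b‖ ≤ 4 * ‖a - b‖ := by
  rw [← ((hasSum_invSqrt h1 ha).sub (hasSum_invSqrt h1 hb)).tsum_eq]
  have hs : HasSum (fun n : ℕ => 2 * (n * (1 / 2 : ℝ) ^ n) * ‖a - b‖) (2 * 2 * ‖a - b‖) := by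
    clear ha hb
    have := hasSum_coe_mul_geometric_of_norm_lt_one (𝕜 := ℝ) (r := 1 / 2) (by norm_num)
    norm_num at this ⊢
    rw [show (4 : ℝ) = 2 * 2 by norm_num]
    simpa using (this.mul_left 2).mul_right ‖a - b‖
  have := tsum_of_norm_bounded hs (f := fun n => invSqrtCoeff n • (a - 1) ^ n -
    invSqrtCoeff n • (b - 1) ^ n) fun n => by
      rw [← smul_sub]
      refine (norm_invSqrtCoeff_smul_le n _).trans ?_
      simpa using norm_pow_sub_pow_le_of_norm_le_half h1 ha hb n
  linarith

/-- By the Cauchy product, the square of the series is the geometric series in 1 - b, which inverts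
b. -/
theorem invSqrt_mul_invSqrt_mul (h1 : ‖(1 : B)‖ ≤ 1) {b : B} (hb : ‖b - 1‖ ≤ 1 / 2) :
    invSqrt b * invSqrt b * b = 1 := by
  have hs := summable_norm_invSqrt h1 hb
  have hsum : invSqrt b * invSqrt b = ∑' n : ℕ, (1 - b) ^ n := by
    rw [invSqrt, tsum_mul_tsum_eq_tsum_sum_antidiagonal_of_summable_norm hs hs]
    refine tsum_congr fun n => ?_
    have : ∀ p ∈ Finset.HasAntidiagonal.antidiagonal n,
        (invSqrtCoeff p.1 • (b - 1) ^ p.1) * (invSqrtCoeff p.2 • (b - 1) ^ p.2) =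
        (invSqrtCoeff p.1 * invSqrtCoeff p.2) • (b - 1) ^ n := fun p hp => by
      rw [smul_mul_smul_comm, ← pow_add, Finset.HasAntidiagonal.mem_antidiagonal.1 hp]
    rw [Finset.sum_congr rfl this, ← Finset.sum_smul, sum_antidiagonal_invSqrtCoeff,
      ← neg_sub b 1, neg_pow (b - 1) n]
    rcases Nat.even_or_odd n with h | h <;> simp [h]
  have hg' := geom_series_mul_neg (1 - b) (by rw [norm_sub_rev]; linarith)
  rw [hsum]
  simpa using hg'

theorem Commute.invSqrt_left (h1 : ‖(1 : B)‖ ≤ 1) {b c : B} (hb : ‖b - 1‖ ≤ 1 / 2)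
    (h : Commute b c) : Commute (invSqrt b) c := by
  have h0 := hasSum_invSqrt h1 hb
  have h2 := h0.mul_left c
  have h3 := h0.mul_right c
  refine h3.unique (h2.congr_fun fun n => ?_)
  have := ((h.sub_left (Commute.one_left c)).pow_left n).eq
  simp only [smul_mul_assoc, mul_smul_comm, this]

theorem invSqrt_conj (h1 : ‖(1 : B)‖ ≤ 1) {b u v : B} (huv : u * v = 1) (hvu : v * u = 1)
    (hb : ‖b - 1‖ ≤ 1 / 2) : invSqrt (u * b * v) = u * invSqrt b * v := by
  refine (((hasSum_invSqrt h1 hb).mul_left u).mul_right v |>.congr_fun fun n => ?_).tsum_eq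
  have hp : ∀ n : ℕ, (u * b * v - 1) ^ n = u * (b - 1) ^ n * v := fun n => by
    induction n with
    | zero => simp [huv]
    | succ n ih =>
      have : u * b * v - 1 = u * (b - 1) * v := by rw [mul_sub, sub_mul, mul_one, huv]
      rw [pow_succ, ih, this, pow_succ]
      calc u * (b - 1) ^ n * v * (u * (b - 1) * v) = u * (b - 1) ^ n * (v * u) * (b - 1) * v := by
            noncomm_ring
        _ = _ := by rw [hvu]; noncomm_ring
  rw [hp, mul_smul_comm, smul_mul_assoc]

end InvSqrt

/-! ### Adjoints, unitaries and polar decomposition on a Hilbert module. -/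

section Operators

variable {A : Type*} [NonUnitalCStarAlgebra A] [PartialOrder A] [StarOrderedRing A]
  {V : Type*} [NormedAddCommGroup V] [NormedSpace ℂ V] [SMul A V] [CStarModule A V]

variable (A) in
/-- `b` is an adjoint of the operator `a` of the Hilbert module `V`. -/
def IsAdj (a b : V →L[ℂ] V) : Prop := ∀ x y : V, inner A (a x) y = inner A x (b y)

/-- The operator underlying an element of `U(𝓛_A(V))`. -/
def op : unitaryGroup A V →* (V →L[ℂ] V) where
  toFun u := (u.1 : V →L[ℂ] V)
  map_one' := rfl
  map_mul' _ _ := rfl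

theorem op_apply (u : unitaryGroup A V) (x : V) : op u x = u.1 x := rfl

theorem op_injective : Function.Injective (op : unitaryGroup A V → V →L[ℂ] V) := fun u v h => by
  ext x
  exact DFunLike.congr_fun h x

@[simp] theorem op_mul_op_inv (u : unitaryGroup A V) : op u * op u⁻¹ = 1 := by
  rw [← map_mul, mul_inv_cancel, map_one]

@[simp] theorem op_inv_mul_op (u : unitaryGroup A V) : op u⁻¹ * op u = 1 := by
  rw [← map_mul, inv_mul_cancel, map_one]

theorem IsHilbertIso.norm_map {u : V ≃L[ℂ] V} (hu : IsHilbertIso A u) (x : V) : ‖u x‖ = ‖x‖ := by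
  rw [CStarModule.norm_eq_sqrt_norm_inner_self (A := A), hu.2,
    ← CStarModule.norm_eq_sqrt_norm_inner_self (A := A)]

theorem norm_op_le (u : unitaryGroup A V) : ‖op u‖ ≤ 1 :=
  ContinuousLinearMap.opNorm_le_bound _ zero_le_one fun x => by
    rw [one_mul, op_apply, u.2.norm_map]

theorem isAdj_op (u : unitaryGroup A V) : IsAdj A (op u) (op u⁻¹) := fun x y => by
  have := u.2.2 x ((u⁻¹).1 y)
  rwa [show u.1 ((u⁻¹).1 y) = y from u.1.apply_symm_apply y] at this

theorem norm_op_mul (u : unitaryGroup A V) (a : V →L[ℂ] V) : ‖op u * a‖ = ‖a‖ := by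
  have h : ∀ (u : unitaryGroup A V) (a : V →L[ℂ] V), ‖op u * a‖ ≤ ‖a‖ := fun u a =>
    (norm_mul_le _ _).trans (mul_le_of_le_one_left (norm_nonneg _) (norm_op_le u))
  refine le_antisymm (h u a) ?_
  simpa [← mul_assoc] using h u⁻¹ (op u * a)

theorem norm_mul_op (u : unitaryGroup A V) (a : V →L[ℂ] V) : ‖a * op u‖ = ‖a‖ := by
  have h : ∀ (u : unitaryGroup A V) (a : V →L[ℂ] V), ‖a * op u‖ ≤ ‖a‖ := fun u a =>
    (norm_mul_le _ _).trans (mul_le_of_le_one_right (norm_nonneg _) (norm_op_le u))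
  refine le_antisymm (h u a) ?_
  simpa [mul_assoc] using h u⁻¹ (a * op u)

theorem IsAdj.symm {a b : V →L[ℂ] V} (h : IsAdj A a b) : IsAdj A b a := fun x y => by
  rw [← CStarModule.star_inner, ← h, CStarModule.star_inner]

theorem IsAdj.mul {a b c d : V →L[ℂ] V} (h : IsAdj A a b) (h' : IsAdj A c d) :
    IsAdj A (a * c) (d * b) := fun x y => by
  rw [mul_apply_eq_comp, mul_apply_eq_comp, h, h']

theorem IsAdj.add {a b c d : V →L[ℂ] V} (h : IsAdj A a b) (h' : IsAdj A c d) :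
    IsAdj A (a + c) (b + d) := fun x y => by
  simp [h x y, h' x y, CStarModule.inner_add_left]

theorem IsAdj.sub {a b c d : V →L[ℂ] V} (h : IsAdj A a b) (h' : IsAdj A c d) :
    IsAdj A (a - c) (b - d) := fun x y => by
  simp [h x y, h' x y]

theorem IsAdj.one : IsAdj A (1 : V →L[ℂ] V) 1 := fun _ _ => rfl

theorem IsAdj.zero : IsAdj A (0 : V →L[ℂ] V) 0 := fun x y => by simp

theorem IsAdj.smul {a b : V →L[ℂ] V} (h : IsAdj A a b) (t : ℝ) : IsAdj A (t • a) (t • b) :=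
  fun x y => by
  simp [h x y, CStarModule.inner_smul_left_real, CStarModule.inner_smul_right_real]

theorem IsAdj.pow {a b : V →L[ℂ] V} (h : IsAdj A a b) (n : ℕ) : IsAdj A (a ^ n) (b ^ n) := by
  induction n with
  | zero => simpa using IsAdj.one
  | succ n ih => rw [pow_succ, pow_succ']; exact ih.mul h

theorem IsAdj.sum {κ : Type*} (s : Finset κ) {a b : κ → V →L[ℂ] V}
    (h : ∀ i ∈ s, IsAdj A (a i) (b i)) : IsAdj A (∑ i ∈ s, a i) (∑ i ∈ s, b i) := by
  classical
  induction s using Finset.induction_on with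
  | empty => simpa using IsAdj.zero
  | insert i s hi ih =>
    rw [Finset.sum_insert hi, Finset.sum_insert hi]
    exact (h i (by simp)).add (ih fun j hj => h j (by simp [hj]))

variable [CompleteSpace V]

theorem IsAdj.invSqrt {b : V →L[ℂ] V} (h : IsAdj A b b) (hb : ‖b - 1‖ ≤ 1 / 2) :
    IsAdj A (invSqrt b) (invSqrt b) := fun x y => by
  have h1 : ‖(1 : V →L[ℂ] V)‖ ≤ 1 := ContinuousLinearMap.norm_id_le
  have hs := (hasSum_invSqrt h1 hb).tendsto_sum_nat
  have hx := (ContinuousLinearMap.apply ℂ V x).continuous.tendsto _ |>.comp hs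
  have hy := (ContinuousLinearMap.apply ℂ V y).continuous.tendsto _ |>.comp hs
  have hc : Continuous fun p : V × V => inner A p.1 p.2 := CStarModule.continuous_inner
  have hl := (hc.tendsto (_, y)).comp (hx.prodMk_nhds tendsto_const_nhds)
  have hr := (hc.tendsto (x, _)).comp ((tendsto_const_nhds (x := x)).prodMk_nhds hy)
  refine tendsto_nhds_unique hl (hr.congr fun n => ?_)
  exact (IsAdj.sum (Finset.range n) (fun i _ => ((h.sub IsAdj.one).pow i).smul _) x y).symm

/-- The unitary part `a (a* a) ^ (-1/2)` in the polar decomposition of an operator `a`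
with adjoint `a'`. -/
noncomputable def polarOp (a a' : V →L[ℂ] V) : V →L[ℂ] V := a * invSqrt (a' * a)

/-- With q = (a' a) ^ (-1/2), the operator q a' is adjoint to a q, and it is a left inverse because
q commutes with a' a. The bound on a a' - 1 makes a a' invertible, which forces q a' to be a right
inverse too. -/
theorem exists_op_eq_polarOp {a a' : V →L[ℂ] V} (h : IsAdj A a a') (h1 : ‖a' * a - 1‖ ≤ 1 / 2)
    (h2 : ‖a * a' - 1‖ ≤ 1 / 2) : ∃ u : unitaryGroup A V, op u = polarOp a a' := by
  have h0 : ‖(1 : V →L[ℂ] V)‖ ≤ 1 := ContinuousLinearMap.norm_id_le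
  set q := invSqrt (a' * a) with hq
  have hqq : q * q * (a' * a) = 1 := invSqrt_mul_invSqrt_mul h0 h1
  have hcomm : q * (a' * a) = (a' * a) * q :=
    (Commute.invSqrt_left h0 h1 (Commute.refl (a' * a))).eq
  have hadj : IsAdj A q q := (h.symm.mul h).invSqrt h1
  have hl : q * a' * (a * q) = 1 := by
    calc q * a' * (a * q) = q * ((a' * a) * q) := by noncomm_ring
      _ = 1 := by rw [← hcomm, ← mul_assoc, hqq]
  obtain ⟨r, hr⟩ : ∃ r, a * a' * r = 1 :=
    ⟨invSqrt (a * a') * invSqrt (a * a'), by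
      have := invSqrt_mul_invSqrt_mul h0 h2
      rwa [mul_assoc, (Commute.invSqrt_left h0 h2 (Commute.refl (a * a'))).eq, ← mul_assoc,
        (Commute.invSqrt_left h0 h2 (Commute.refl (a * a'))).eq, mul_assoc] at this⟩
  have hr' : a * q * (q * a') = 1 := by
    calc a * q * (q * a') = a * (q * q) * a' * (a * a' * r) := by rw [hr]; noncomm_ring
      _ = a * (q * q * (a' * a)) * a' * r := by noncomm_ring
      _ = 1 := by rw [hqq, mul_one, hr]
  let e : V ≃L[ℂ] V := ContinuousLinearEquiv.equivOfInverse (a * q) (q * a')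
    (fun x => DFunLike.congr_fun hl x) (fun x => DFunLike.congr_fun hr' x)
  have hin : ∀ x y : V, inner A (e x) (e y) = inner A x y := fun x y => by
    have := (h.mul hadj) x ((a * q) y)
    rw [show (q * a') ((a * q) y) = y from DFunLike.congr_fun hl y] at this
    exact this
  refine ⟨⟨e, fun c x => ?_, hin⟩, rfl⟩
  -- A surjection that preserves the inner product is A-linear: the defect of linearity is
  -- orthogonal to everything.
  have : ∀ z, inner A z (e (c • x) - c • e x) = 0 := fun z => by
    obtain ⟨y, rfl⟩ := e.surjective z
    rw [CStarModule.inner_sub_right, CStarModule.inner_op_smul_right, hin, hin,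
      CStarModule.inner_op_smul_right, sub_self]
  exact sub_eq_zero.1 (CStarModule.inner_self.1 (this _))

open Classical in
/-- The unitary part of an operator `a` with adjoint `a'`, as an element of `U(𝓛_A(V))`. -/
noncomputable def polar (a a' : V →L[ℂ] V) : unitaryGroup A V :=
  if h : ∃ u : unitaryGroup A V, op u = polarOp a a' then h.choose else 1

/-- The radius 1/5 is small enough: 6/5 · 1/5 + 1/5 = 11/25 < 1/2, the radius used for `invSqrt`. -/
theorem norm_mul_sub_one_le {u : unitaryGroup A V} {a a' : V →L[ℂ] V} (h : ‖a - op u‖ ≤ 1 / 5)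
    (h' : ‖a' - op u⁻¹‖ ≤ 1 / 5) : ‖a' * a - 1‖ ≤ 1 / 2 := by
  have ha : ‖a'‖ ≤ 6 / 5 := by
    calc ‖a'‖ = ‖(a' - op u⁻¹) + op u⁻¹‖ := by rw [sub_add_cancel]
      _ ≤ 1 / 5 + 1 := (norm_add_le _ _).trans (add_le_add h' (norm_op_le _))
      _ = 6 / 5 := by norm_num
  calc ‖a' * a - 1‖ = ‖a' * (a - op u) + (a' - op u⁻¹) * op u‖ := by
        rw [mul_sub, sub_mul, op_inv_mul_op]; congr 1; abel
    _ ≤ 6 / 5 * (1 / 5) + 1 / 5 := by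
        refine (norm_add_le _ _).trans (add_le_add ?_ ?_)
        · exact (norm_mul_le _ _).trans (mul_le_mul ha h (norm_nonneg _) (by norm_num))
        · rwa [norm_mul_op]
    _ ≤ 1 / 2 := by norm_num

variable (A) in
/-- `a` and its adjoint `a'` are `1/5`-close to a unitary and its inverse. -/
def NearUnitary (a a' : V →L[ℂ] V) : Prop :=
  IsAdj A a a' ∧ ∃ u : unitaryGroup A V, ‖a - op u‖ ≤ 1 / 5 ∧ ‖a' - op u⁻¹‖ ≤ 1 / 5

theorem nearUnitary_op (u : unitaryGroup A V) : NearUnitary A (op u) (op u⁻¹) :=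
  ⟨isAdj_op u, u, by simp, by simp⟩

theorem NearUnitary.norm_mul_sub_one_le {a a' : V →L[ℂ] V} (h : NearUnitary A a a') :
    ‖a' * a - 1‖ ≤ 1 / 2 :=
  let ⟨_, h1, h2⟩ := h.2
  AlmostFlat.norm_mul_sub_one_le h1 h2

theorem NearUnitary.norm_le {a a' : V →L[ℂ] V} (h : NearUnitary A a a') :
    ‖a‖ ≤ 6 / 5 ∧ ‖a'‖ ≤ 6 / 5 := by
  obtain ⟨u, h1, h2⟩ := h.2
  have key : ∀ (u : unitaryGroup A V) (a : V →L[ℂ] V), ‖a - op u‖ ≤ 1 / 5 → ‖a‖ ≤ 6 / 5 :=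
    fun u a h => by
    calc ‖a‖ = ‖(a - op u) + op u‖ := by rw [sub_add_cancel]
      _ ≤ 1 / 5 + 1 := (norm_add_le _ _).trans (add_le_add h (norm_op_le _))
      _ = 6 / 5 := by norm_num
  exact ⟨key u a h1, key u⁻¹ a' h2⟩

theorem NearUnitary.op_polar {a a' : V →L[ℂ] V} (h : NearUnitary A a a') :
    op (polar a a' : unitaryGroup A V) = polarOp a a' := by
  obtain ⟨hadj, u, h1, h2⟩ := h
  have hex := exists_op_eq_polarOp hadj (AlmostFlat.norm_mul_sub_one_le h1 h2)
    (AlmostFlat.norm_mul_sub_one_le (u := u⁻¹) h2 (by rwa [inv_inv]))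
  rw [polar, dif_pos hex]
  exact hex.choose_spec

theorem polar_op (u : unitaryGroup A V) : polar (op u) (op u⁻¹) = u := by
  apply op_injective
  rw [(nearUnitary_op u).op_polar, polarOp, op_inv_mul_op, invSqrt_one, mul_one]

theorem NearUnitary.mul_op {a a' : V →L[ℂ] V} (h : NearUnitary A a a') (u v : unitaryGroup A V) :
    NearUnitary A (op u * a * op v) (op v⁻¹ * a' * op u⁻¹) := by
  obtain ⟨hadj, w, h1, h2⟩ := h
  refine ⟨?_, u * w * v, ?_, ?_⟩
  · simpa [mul_assoc] using ((isAdj_op u).mul hadj).mul (isAdj_op v)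
  · rwa [map_mul, map_mul, ← sub_mul, ← mul_sub, norm_mul_op, norm_op_mul]
  · rwa [mul_inv_rev, mul_inv_rev, map_mul, map_mul, ← mul_assoc, ← sub_mul, ← mul_sub,
      norm_mul_op, norm_op_mul]

/-- Here a' a is only conjugated by v, and `invSqrt` commutes with conjugation. This equivariance
makes the unitary part independent of the unitary frames in which an operator is written. -/
theorem NearUnitary.polar_mul_op {a a' : V →L[ℂ] V} (h : NearUnitary A a a')
    (u v : unitaryGroup A V) :
    polar (op u * a * op v) (op v⁻¹ * a' * op u⁻¹) = u * polar a a' * v := by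
  have h0 : ‖(1 : V →L[ℂ] V)‖ ≤ 1 := ContinuousLinearMap.norm_id_le
  apply op_injective
  rw [(h.mul_op u v).op_polar, map_mul, map_mul, h.op_polar, polarOp, polarOp]
  have : op v⁻¹ * a' * op u⁻¹ * (op u * a * op v) = op v⁻¹ * (a' * a) * op v := by
    calc _ = op v⁻¹ * a' * (op u⁻¹ * op u) * a * op v := by noncomm_ring
      _ = _ := by rw [op_inv_mul_op]; noncomm_ring
  rw [this, invSqrt_conj h0 (op_inv_mul_op v) (op_mul_op_inv v) h.norm_mul_sub_one_le]
  calc op u * a * op v * (op v⁻¹ * invSqrt (a' * a) * op v)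
      = op u * a * (op v * op v⁻¹) * invSqrt (a' * a) * op v := by noncomm_ring
    _ = _ := by rw [op_mul_op_inv]; noncomm_ring

/-- Norms up to 6/5, the bound 2 for `invSqrt` and its Lipschitz constant 4 give 2 + 4 · (6/5)² < 8
and 4 · (6/5)² < 6. -/
theorem NearUnitary.norm_polar_sub_le {a a' b b' : V →L[ℂ] V} (ha : NearUnitary A a a')
    (hb : NearUnitary A b b') :
    ‖op (polar a a' : unitaryGroup A V) - op (polar b b' : unitaryGroup A V)‖ ≤
      8 * ‖a - b‖ + 6 * ‖a' - b'‖ := by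
  have h0 : ‖(1 : V →L[ℂ] V)‖ ≤ 1 := ContinuousLinearMap.norm_id_le
  have h1 : ‖a' * a - b' * b‖ ≤ 6 / 5 * ‖a - b‖ + ‖a' - b'‖ * (6 / 5) := by
    calc ‖a' * a - b' * b‖ = ‖a' * (a - b) + (a' - b') * b‖ := by
          rw [mul_sub, sub_mul]; congr 1; abel
      _ ≤ _ := (norm_add_le _ _).trans (add_le_add
        ((norm_mul_le _ _).trans (mul_le_mul_of_nonneg_right ha.norm_le.2 (norm_nonneg _)))
        ((norm_mul_le _ _).trans (mul_le_mul_of_nonneg_left hb.norm_le.1 (norm_nonneg _))))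
  have h2 := norm_invSqrt_sub_le h0 ha.norm_mul_sub_one_le hb.norm_mul_sub_one_le
  rw [ha.op_polar, hb.op_polar, polarOp, polarOp]
  calc ‖a * invSqrt (a' * a) - b * invSqrt (b' * b)‖
      = ‖(a - b) * invSqrt (a' * a) + b * (invSqrt (a' * a) - invSqrt (b' * b))‖ := by
        rw [mul_sub, sub_mul]; congr 1; abel
    _ ≤ ‖a - b‖ * 2 + 6 / 5 * (4 * (6 / 5 * ‖a - b‖ + ‖a' - b'‖ * (6 / 5))) := by
        refine (norm_add_le _ _).trans (add_le_add ?_ ?_)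
        · exact (norm_mul_le _ _).trans (mul_le_mul_of_nonneg_left
            (norm_invSqrt_le h0 ha.norm_mul_sub_one_le) (norm_nonneg _))
        · exact (norm_mul_le _ _).trans (mul_le_mul hb.norm_le.1
            (h2.trans (by linarith)) (norm_nonneg _) (by norm_num))
    _ ≤ _ := by nlinarith [norm_nonneg (a - b), norm_nonneg (a' - b')]

end Operators
end AlmostFlat


namespace AlmostFlat
set_option linter.unusedSectionVars false

/-! ### Radial projection from a vertex, and cones over Lipschitz functions. -/

section Interpolation

variable {ι : Type*} [Fintype ι] [DecidableEq ι] {X : AbstractSimplicialComplex ι}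

theorem realization_le_one (x : realization X) (i : ι) : x.1 i ≤ 1 := by
  rw [← x.2.2.1]
  exact Finset.single_le_sum (fun j _ => x.2.1 j) (Finset.mem_univ i)

theorem norm_realization_le_one (x : realization X) : ‖x.1‖ ≤ 1 := by
  rw [EuclideanSpace.norm_eq, Real.sqrt_le_iff, one_pow, ← x.2.2.1]
  refine ⟨Finset.sum_nonneg fun i _ => x.2.1 i, ?_⟩
  refine Finset.sum_le_sum fun i _ => ?_
  rw [Real.norm_of_nonneg (x.2.1 i), sq]
  exact mul_le_of_le_one_left (x.2.1 i) (realization_le_one x i)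

/-- The projection of `x ≠ w` from the vertex `w` to the face opposite to `w`. -/
noncomputable def project (w : ι) (x : realization X) : realization X :=
  -- The value at the vertex w is immaterial, since the cone construction scales it by 1 - x.1 w =
  -- 0.
  if h : x.1 w = 1 then x else
  ⟨(1 - x.1 w)⁻¹ • (x.1 - x.1 w • EuclideanSpace.single w 1), by
    obtain ⟨σ, hσ, hs⟩ := x.2.2.2
    have h1 : 0 < 1 - x.1 w := sub_pos.2 (lt_of_le_of_ne (realization_le_one x w) h)
    refine mem_realization hσ (fun i => ?_) ?_ (fun i hi => ?_)
    · simp only [PiLp.smul_apply, PiLp.sub_apply, PiLp.single_apply, smul_eq_mul]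
      refine mul_nonneg (inv_nonneg.2 h1.le) ?_
      split_ifs with hi
      · simp [hi]
      · simpa using x.2.1 i
    · simp only [PiLp.smul_apply, PiLp.sub_apply, PiLp.single_apply, smul_eq_mul]
      rw [← Finset.mul_sum, Finset.sum_sub_distrib, x.2.2.1]
      simp [h1.ne']
    · by_contra hn
      have h0 : x.1 i = 0 := not_not.1 fun h => hn ((hs i).1 h)
      have hiw : i ≠ w ∨ x.1 w = 0 := by
        by_cases e : i = w
        · exact Or.inr (e ▸ h0)
        · exact Or.inl e
      apply hi
      rcases hiw with e | e <;> simp [h0, e]⟩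

theorem project_apply {w : ι} {x : realization X} (h : x.1 w ≠ 1) :
    (1 - x.1 w) • (project w x).1 = x.1 - x.1 w • EuclideanSpace.single w 1 := by
  rw [project, dif_neg h]
  exact smul_inv_smul₀ (sub_ne_zero.2 (Ne.symm h)) _

theorem project_of_eq_zero {w : ι} {x : realization X} (h : x.1 w = 0) : project w x = x := by
  have h1 := project_apply (w := w) (x := x) (by rw [h]; exact zero_ne_one)
  apply Subtype.ext
  simpa [h] using h1

theorem project_mem_cell {w : ι} {x : realization X} {σ : Finset ι} (hx : x ∈ cell X σ) :
    project w x ∈ cell X σ := by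
  by_cases h : x.1 w = 1
  · rwa [project, dif_pos h]
  intro i hi
  refine hx i fun h0 => hi ?_
  have h1 := congrArg (fun y : EuclideanSpace ℝ ι => y i) (project_apply h)
  simp only [PiLp.smul_apply, PiLp.sub_apply, PiLp.single_apply, smul_eq_mul, h0] at h1
  have h2 : 1 - x.1 w ≠ 0 := sub_ne_zero.2 (Ne.symm h)
  refine (mul_eq_zero.1 (h1.trans ?_)).resolve_left h2
  split_ifs with e
  · rw [← e, h0]; simp
  · simp

theorem project_mem_cell_of_insert {w : ι} {x : realization X} {S : Finset ι} (h : x.1 w ≠ 1)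
    (hx : x ∈ cell X (insert w S)) : project w x ∈ cell X S := by
  intro i hi
  have := project_mem_cell (w := w) hx i hi
  refine (Finset.mem_insert.1 this).resolve_left fun e => hi ?_
  subst e
  have h1 := congrArg (fun y : EuclideanSpace ℝ ι => y i) (project_apply h)
  simp only [PiLp.smul_apply, PiLp.sub_apply, PiLp.single_apply, smul_eq_mul] at h1
  exact (mul_eq_zero.1 (h1.trans (by simp))).resolve_left (sub_ne_zero.2 (Ne.symm h))

theorem abs_sub_le_dist (x y : realization X) (i : ι) : |x.1 i - y.1 i| ≤ dist x y := by
  rw [Subtype.dist_eq, dist_eq_norm]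
  exact PiLp.norm_apply_le (x.1 - y.1) i

/-- The projection is not uniformly Lipschitz near w, but the scaling compensates: with P the
projection and e_w the vertex, (1 - y_w) (Px - Py) = (x - y) + (x_w - y_w) (Px - e_w), where Px and
e_w have norm at most 1. -/
theorem mul_dist_project_le {w : ι} {x y : realization X} (hx : x.1 w ≠ 1) (hy : y.1 w ≠ 1) :
    (1 - y.1 w) * dist (project w x) (project w y) ≤ 3 * dist x y := by
  have h1 : 0 ≤ 1 - y.1 w := sub_nonneg.2 (realization_le_one y w)
  have h2 : (1 - y.1 w) • ((project w x).1 - (project w y).1) =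
      (x.1 - y.1) + (x.1 w - y.1 w) • (project w x).1 -
        (x.1 w - y.1 w) • EuclideanSpace.single w (1 : ℝ) := by
    rw [smul_sub, project_apply hy, show (1 - y.1 w) • (project w x).1 =
      (1 - x.1 w) • (project w x).1 + (x.1 w - y.1 w) • (project w x).1 by
        rw [← add_smul]; congr 1; ring, project_apply hx, sub_smul _ _ (EuclideanSpace.single w _)]
    abel
  have h3 := congrArg norm h2
  rw [norm_smul, Real.norm_of_nonneg h1, ← dist_eq_norm, ← Subtype.dist_eq] at h3
  rw [h3]
  have h4 : ‖x.1 - y.1‖ = dist x y := by rw [Subtype.dist_eq, dist_eq_norm]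
  have h5 : |x.1 w - y.1 w| ≤ dist x y := abs_sub_le_dist x y w
  calc _ ≤ ‖x.1 - y.1‖ + |x.1 w - y.1 w| * 1 + |x.1 w - y.1 w| * 1 := by
        refine (norm_sub_le _ _).trans (add_le_add ((norm_add_le _ _).trans
          (add_le_add le_rfl ?_)) ?_)
        · rw [norm_smul]
          exact mul_le_mul_of_nonneg_left (norm_realization_le_one _) (abs_nonneg _)
        · rw [norm_smul]
          simp
    _ ≤ _ := by rw [h4]; linarith

/-- A Lipschitz function on the face opposite to `w`, scaled by the distance to `w`, is a Lipschitz
function on the whole simplex. -/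
theorem norm_cone_sub_le {W : Type*} [NormedAddCommGroup W] [NormedSpace ℝ W] {w : ι} {K : ℝ}
    (hK : 0 ≤ K) {x y : realization X} (f : realization X → W)
    (hf : ∀ z ∈ ({x, y} : Set (realization X)), z.1 w ≠ 1 → ‖f (project w z)‖ ≤ K)
    (hl : x.1 w ≠ 1 → y.1 w ≠ 1 → ‖f (project w x) - f (project w y)‖ ≤
      K * dist (project w x) (project w y)) :
    ‖(1 - x.1 w) • f (project w x) - (1 - y.1 w) • f (project w y)‖ ≤ 4 * K * dist x y := by
  have hd := abs_sub_le_dist x y w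
  have hd' : |y.1 w - x.1 w| ≤ dist x y := by rwa [abs_sub_comm]
  have hKd : 0 ≤ K * dist x y := mul_nonneg hK dist_nonneg
  by_cases hx : x.1 w = 1
  · by_cases hy : y.1 w = 1
    · simp only [hx, hy, sub_self, zero_smul, norm_zero]; linarith
    · rw [hx, sub_self, zero_smul, zero_sub, norm_neg, norm_smul, Real.norm_eq_abs, ← hx]
      have := mul_le_mul hd (hf y (by simp) hy) (norm_nonneg _) dist_nonneg
      linarith
  · by_cases hy : y.1 w = 1
    · rw [hy, sub_self, zero_smul, sub_zero, norm_smul, Real.norm_eq_abs, ← hy]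
      have := mul_le_mul hd' (hf x (by simp) hx) (norm_nonneg _) dist_nonneg
      linarith
    · have h1 : 0 ≤ 1 - y.1 w := sub_nonneg.2 (realization_le_one y w)
      -- A product rule: the first summand costs K · dist, the second 3 K · dist by
      -- `mul_dist_project_le`.
      have h2 : (1 - x.1 w) • f (project w x) - (1 - y.1 w) • f (project w y) =
          (y.1 w - x.1 w) • f (project w x) +
            (1 - y.1 w) • (f (project w x) - f (project w y)) := by
        rw [smul_sub, show (1 - x.1 w) = (y.1 w - x.1 w) + (1 - y.1 w) by ring, add_smul]
        abel
      have h3 := mul_le_mul hd' (hf x (by simp) hx) (norm_nonneg _) dist_nonneg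
      have h4 := mul_le_mul_of_nonneg_left (hl hx hy) h1
      have h5 := mul_le_mul_of_nonneg_left (mul_dist_project_le hx hy) hK
      rw [h2]
      refine (norm_add_le _ _).trans ?_
      rw [norm_smul, norm_smul, Real.norm_eq_abs, Real.norm_of_nonneg h1]
      linarith

end Interpolation


/-! ### The operator-norm distance of unitaries is bi-invariant, so errors add up along products. -/

section Distance

variable {A : Type*} [NonUnitalCStarAlgebra A] [PartialOrder A] [StarOrderedRing A]
  {V : Type*} [NormedAddCommGroup V] [NormedSpace ℂ V] [SMul A V] [CStarModule A V]

theorem norm_op_mul_sub_le (u v u' v' : unitaryGroup A V) :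
    ‖op (u * v) - op (u' * v')‖ ≤ ‖op u - op u'‖ + ‖op v - op v'‖ := by
  have h : op (u * v) - op (u' * v') = (op u - op u') * op v + op u' * (op v - op v') := by
    rw [map_mul, map_mul, sub_mul, mul_sub]; abel
  rw [h]
  refine (norm_add_le _ _).trans ?_
  rw [norm_mul_op, norm_op_mul]

theorem norm_op_inv_sub (u v : unitaryGroup A V) : ‖op u⁻¹ - op v⁻¹‖ = ‖op u - op v‖ := by
  have h : op u⁻¹ - op v⁻¹ = op u⁻¹ * (op v - op u) * op v⁻¹ := by
    rw [mul_sub, sub_mul, mul_assoc, op_mul_op_inv, op_inv_mul_op, one_mul, mul_one]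
  rw [h, norm_mul_op, norm_op_mul, norm_sub_rev]

theorem norm_op_mul_left_sub (w u v : unitaryGroup A V) :
    ‖op (w * u) - op (w * v)‖ = ‖op u - op v‖ := by
  rw [map_mul, map_mul, ← mul_sub, norm_op_mul]

theorem norm_op_mul_right_sub (w u v : unitaryGroup A V) :
    ‖op (u * w) - op (v * w)‖ = ‖op u - op v‖ := by
  rw [map_mul, map_mul, ← sub_mul, norm_mul_op]

end Distance

/-! ### From almost cocycles on edges to exact Lipschitz cocycles. -/

section Cocycles

variable {ι : Type*} [Fintype ι] [DecidableEq ι] (X : AbstractSimplicialComplex ι)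
  {A : Type*} [NonUnitalCStarAlgebra A] [PartialOrder A] [StarOrderedRing A]
  {V : Type*} [NormedAddCommGroup V] [NormedSpace ℂ V] [SMul A V] [CStarModule A V]

/-- A family of unitaries on the edges of `X` which is a cocycle up to `ε`. -/
def IsAlmostCocycle (ε : ℝ) (u : ι → ι → unitaryGroup A V) : Prop :=
  ∀ σ ∈ X.faces, ∀ a ∈ σ, ∀ b ∈ σ, ∀ c ∈ σ, ‖op (u a b * u b c) - op (u a c)‖ ≤ ε

/-- A family of functions `g a b` on the simplices containing `a` and `b`, restricted to points
supported in `S`, which is a cocycle, `K`-close to `u` and `K`-Lipschitz on simplices. -/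
structure IsCocycleOn (S : Finset ι) (K : ℝ) (u : ι → ι → unitaryGroup A V)
    (g : ι → ι → realization X → unitaryGroup A V) : Prop where
  mul : ∀ σ ∈ X.faces, ∀ a ∈ σ, ∀ b ∈ σ, ∀ c ∈ σ, ∀ x ∈ cell X σ, x ∈ cell X S →
    g a b x * g b c x = g a c x
  close : ∀ σ ∈ X.faces, ∀ a ∈ σ, ∀ b ∈ σ, ∀ x ∈ cell X σ, x ∈ cell X S →
    ‖op (g a b x) - op (u a b)‖ ≤ K
  lipschitz : ∀ σ ∈ X.faces, ∀ a ∈ σ, ∀ b ∈ σ, ∀ x ∈ cell X σ, ∀ y ∈ cell X σ,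
    x ∈ cell X S → y ∈ cell X S → ‖op (g a b x) - op (g a b y)‖ ≤ K * dist x y

variable {X}

/-- The linear interpolation between `u` at the vertex `w` and the function `g` on the face opposite
to `w`. -/
noncomputable def coneOp (w : ι) (u : unitaryGroup A V) (g : realization X → unitaryGroup A V)
    (x : realization X) : V →L[ℂ] V :=
  (1 - x.1 w) • (op (g (project w x)) - op u) + op u

theorem norm_coneOp_sub_le {w : ι} {u : unitaryGroup A V} {g : realization X → unitaryGroup A V}
    {x : realization X} {K : ℝ} (hK : 0 ≤ K)
    (h : x.1 w ≠ 1 → ‖op (g (project w x)) - op u‖ ≤ K) : ‖coneOp w u g x - op u‖ ≤ K := by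
  rw [coneOp, add_sub_cancel_right, norm_smul]
  by_cases hx : x.1 w = 1
  · simpa [hx] using hK
  · rw [Real.norm_of_nonneg (sub_nonneg.2 (realization_le_one x w))]
    exact (mul_le_of_le_one_left (norm_nonneg _) (by linarith [x.2.1 w])).trans (h hx)

theorem isAdj_coneOp (w : ι) (u : unitaryGroup A V) (g : realization X → unitaryGroup A V)
    (x : realization X) : IsAdj A (coneOp w u g x) (coneOp w u⁻¹ (fun y => (g y)⁻¹) x) :=
  (((isAdj_op _).sub (isAdj_op _)).smul _).add (isAdj_op _)

theorem coneOp_of_eq_zero {w : ι} {u : unitaryGroup A V} {g : realization X → unitaryGroup A V}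
    {x : realization X} (h : x.1 w = 0) : coneOp w u g x = op (g x) := by
  simp [coneOp, h, project_of_eq_zero h]

variable [CompleteSpace V]

/-- On a simplex containing w, let k v be the unitary part of the interpolation between u w v at w
and g w v on the opposite face. The new functions (k v)⁻¹ * k v' are coboundaries there, hence
satisfy the cocycle identity automatically. On the opposite face they reduce to g, because g itself
is a cocycle. -/
theorem IsCocycleOn.exists_insert {S : Finset ι} {K ε : ℝ} {u : ι → ι → unitaryGroup A V}
    {g : ι → ι → realization X → unitaryGroup A V} (hg : IsCocycleOn X S K u g) (hK : 0 ≤ K)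
    (hu : IsAlmostCocycle X ε u) (hε : ε ≤ K) (hK' : K ≤ 1 / 5) (w : ι) :
    ∃ g', IsCocycleOn X (insert w S) (200 * K) u g' := by
  classical
  let a : ι → realization X → (V →L[ℂ] V) := fun v => coneOp w (u w v) (g w v)
  let a' : ι → realization X → (V →L[ℂ] V) := fun v => coneOp w (u w v)⁻¹ fun y => (g w v y)⁻¹
  let k : ι → realization X → unitaryGroup A V := fun v x => polar (a v x) (a' v x)
  -- Where x.1 w = 0, the vertices v and v' need not share a simplex with w, so g is kept.
  let g' : ι → ι → realization X → unitaryGroup A V := fun v v' x =>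
    if x.1 w = 0 then g v v' x else (k v x)⁻¹ * k v' x
  have hclose : ∀ σ ∈ X.faces, w ∈ σ → ∀ v ∈ σ, ∀ x ∈ cell X σ, x ∈ cell X (insert w S) →
      x.1 w ≠ 1 → ‖op (g w v (project w x)) - op (u w v)‖ ≤ K := fun σ hσ hw v hv x hx hxS h =>
    hg.close σ hσ w hw v hv _ (project_mem_cell hx) (project_mem_cell_of_insert h hxS)
  have ha : ∀ σ ∈ X.faces, w ∈ σ → ∀ v ∈ σ, ∀ x ∈ cell X σ, x ∈ cell X (insert w S) →
      ‖a v x - op (u w v)‖ ≤ K ∧ ‖a' v x - op (u w v)⁻¹‖ ≤ K := fun σ hσ hw v hv x hx hxS =>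
    ⟨norm_coneOp_sub_le hK (hclose σ hσ hw v hv x hx hxS),
      norm_coneOp_sub_le hK fun h => by
        rw [norm_op_inv_sub]; exact hclose σ hσ hw v hv x hx hxS h⟩
  have hnear : ∀ σ ∈ X.faces, w ∈ σ → ∀ v ∈ σ, ∀ x ∈ cell X σ, x ∈ cell X (insert w S) →
      NearUnitary A (a v x) (a' v x) := fun σ hσ hw v hv x hx hxS =>
    ⟨isAdj_coneOp _ _ _ _, u w v, (ha σ hσ hw v hv x hx hxS).1.trans hK',
      (ha σ hσ hw v hv x hx hxS).2.trans hK'⟩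
  -- 14 = 8 + 6, from `NearUnitary.norm_polar_sub_le`. The cone multiplies Lipschitz constants by 4,
  -- whence 56 = 14 · 4 below. Two factors k give 28 K + ε and 112 K, both within 200 K.
  have hkclose : ∀ σ ∈ X.faces, w ∈ σ → ∀ v ∈ σ, ∀ x ∈ cell X σ, x ∈ cell X (insert w S) →
      ‖op (k v x) - op (u w v)‖ ≤ 14 * K := fun σ hσ hw v hv x hx hxS => by
    have h1 := (hnear σ hσ hw v hv x hx hxS).norm_polar_sub_le (nearUnitary_op (u w v))
    rw [polar_op] at h1
    have h2 := ha σ hσ hw v hv x hx hxS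
    exact h1.trans (by linarith [h2.1, h2.2])
  have hklip : ∀ σ ∈ X.faces, w ∈ σ → ∀ v ∈ σ, ∀ x ∈ cell X σ, ∀ y ∈ cell X σ,
      x ∈ cell X (insert w S) → y ∈ cell X (insert w S) →
      ‖op (k v x) - op (k v y)‖ ≤ 56 * K * dist x y := fun σ hσ hw v hv x hx y hy hxS hyS => by
    have h1 := (hnear σ hσ hw v hv x hx hxS).norm_polar_sub_le (hnear σ hσ hw v hv y hy hyS)
    have hz : ∀ z ∈ ({x, y} : Set (realization X)), z ∈ cell X σ ∧ z ∈ cell X (insert w S) := by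
      rintro z (rfl | rfl)
      exacts [⟨hx, hxS⟩, ⟨hy, hyS⟩]
    have h2 : ‖a v x - a v y‖ ≤ 4 * K * dist x y := by
      have := norm_cone_sub_le (w := w) hK (x := x) (y := y) (fun z => op (g w v z) - op (u w v))
        (fun z h => hclose σ hσ hw v hv z (hz z h).1 (hz z h).2) (fun h h' => by
          rw [sub_sub_sub_cancel_right]
          exact hg.lipschitz σ hσ w hw v hv _ (project_mem_cell hx) _ (project_mem_cell hy)
            (project_mem_cell_of_insert h hxS) (project_mem_cell_of_insert h' hyS))
      simpa [a, coneOp] using this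
    have h3 : ‖a' v x - a' v y‖ ≤ 4 * K * dist x y := by
      have := norm_cone_sub_le (w := w) hK (x := x) (y := y)
        (fun z => op (g w v z)⁻¹ - op (u w v)⁻¹)
        (fun z h h' => by
          rw [norm_op_inv_sub]; exact hclose σ hσ hw v hv z (hz z h).1 (hz z h).2 h')
        (fun h h' => by
          rw [sub_sub_sub_cancel_right, norm_op_inv_sub]
          exact hg.lipschitz σ hσ w hw v hv _ (project_mem_cell hx) _ (project_mem_cell hy)
            (project_mem_cell_of_insert h hxS) (project_mem_cell_of_insert h' hyS))
      simpa [a', coneOp] using this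
    exact h1.trans (by linarith)
  have hS : ∀ x ∈ cell X (insert w S), x.1 w = 0 → x ∈ cell X S := fun x hx h0 i hi =>
    (Finset.mem_insert.1 (hx i hi)).resolve_left fun e => hi (e ▸ h0)
  have hg' : ∀ σ ∈ X.faces, w ∈ σ → ∀ v ∈ σ, ∀ v' ∈ σ, ∀ x ∈ cell X σ,
      x ∈ cell X (insert w S) → g' v v' x = (k v x)⁻¹ * k v' x := by
    intro σ hσ hw v hv v' hv' x hx hxS
    by_cases h0 : x.1 w = 0
    · have hk : ∀ v, k v x = g w v x := fun v => by
        simp only [k, a, a', coneOp_of_eq_zero h0, polar_op]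
      simp only [g', if_pos h0, hk]
      rw [eq_inv_mul_iff_mul_eq]
      exact hg.mul σ hσ w hw v hv v' hv' x hx (hS x hxS h0)
    · simp only [g', if_neg h0]
  have hg'' : ∀ σ ∈ X.faces, w ∉ σ → ∀ v v', ∀ x ∈ cell X σ, x ∈ cell X (insert w S) →
      g' v v' x = g v v' x ∧ x ∈ cell X S := fun σ hσ hw v v' x hx hxS => by
    have h0 : x.1 w = 0 := not_not.1 fun h => hw (hx w h)
    exact ⟨if_pos h0, hS x hxS h0⟩
  refine ⟨g', ⟨?_, ?_, ?_⟩⟩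
  · intro σ hσ v hv v' hv' v'' hv'' x hx hxS
    by_cases hw : w ∈ σ
    · rw [hg' σ hσ hw v hv v' hv' x hx hxS, hg' σ hσ hw v' hv' v'' hv'' x hx hxS,
        hg' σ hσ hw v hv v'' hv'' x hx hxS]
      group
    · rw [(hg'' σ hσ hw _ _ x hx hxS).1, (hg'' σ hσ hw _ _ x hx hxS).1,
        (hg'' σ hσ hw _ _ x hx hxS).1]
      exact hg.mul σ hσ v hv v' hv' v'' hv'' x hx (hg'' σ hσ hw v v' x hx hxS).2
  · intro σ hσ v hv v' hv' x hx hxS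
    by_cases hw : w ∈ σ
    · rw [hg' σ hσ hw v hv v' hv' x hx hxS]
      have h1 := norm_op_mul_sub_le (k v x)⁻¹ (k v' x) (u w v)⁻¹ (u w v')
      rw [norm_op_inv_sub] at h1
      have h2 := hu σ hσ w hw v hv v' hv'
      rw [← norm_op_mul_left_sub (u w v)⁻¹, inv_mul_cancel_left, norm_sub_rev] at h2
      have h3 := norm_sub_le_norm_sub_add_norm_sub (op ((k v x)⁻¹ * k v' x))
        (op ((u w v)⁻¹ * u w v')) (op (u v v'))
      linarith [hkclose σ hσ hw v hv x hx hxS, hkclose σ hσ hw v' hv' x hx hxS]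
    · rw [(hg'' σ hσ hw _ _ x hx hxS).1]
      exact (hg.close σ hσ v hv v' hv' x hx (hg'' σ hσ hw v v' x hx hxS).2).trans (by linarith)
  · intro σ hσ v hv v' hv' x hx y hy hxS hyS
    have hKd : 0 ≤ K * dist x y := mul_nonneg hK dist_nonneg
    by_cases hw : w ∈ σ
    · rw [hg' σ hσ hw v hv v' hv' x hx hxS, hg' σ hσ hw v hv v' hv' y hy hyS]
      have h1 := norm_op_mul_sub_le (k v x)⁻¹ (k v' x) (k v y)⁻¹ (k v' y)
      rw [norm_op_inv_sub] at h1
      linarith [hklip σ hσ hw v hv x hx y hy hxS hyS, hklip σ hσ hw v' hv' x hx y hy hxS hyS]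
    · rw [(hg'' σ hσ hw _ _ x hx hxS).1, (hg'' σ hσ hw _ _ y hy hyS).1]
      exact (hg.lipschitz σ hσ v hv v' hv' x hx y hy (hg'' σ hσ hw v v' x hx hxS).2
        (hg'' σ hσ hw v v' y hy hyS).2).trans (by linarith)

/-- Near an almost cocycle on the edges of `X` there is a cocycle of Lipschitz functions. -/
theorem IsAlmostCocycle.exists_isCocycleOn {ε : ℝ} (hε : 0 ≤ ε) {u : ι → ι → unitaryGroup A V}
    (hu : IsAlmostCocycle X ε u) (S : Finset ι) (hS : 200 ^ S.card * ε ≤ 1 / 5) :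
    ∃ g, IsCocycleOn X S (200 ^ S.card * ε) u g := by
  induction S using Finset.induction_on with
  | empty =>
    have h : ∀ x : realization X, x ∉ cell X ∅ := fun x hx => by
      have h1 := x.2.2.1
      rw [Finset.sum_eq_zero fun i _ => not_not.1 fun hi => by simpa using hx i hi] at h1
      exact zero_ne_one h1
    exact ⟨fun a b _ => u a b, fun _ _ _ _ _ _ _ _ x _ hx => (h x hx).elim,
      fun _ _ _ _ _ _ x _ hx => (h x hx).elim, fun _ _ _ _ _ _ x _ _ _ hx => (h x hx).elim⟩
  | insert w S hw ih =>
    rw [Finset.card_insert_of_notMem hw, pow_succ'] at hS ⊢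
    have h0 : 0 ≤ 200 ^ S.card * ε := by positivity
    obtain ⟨g, hg⟩ := ih (by linarith)
    obtain ⟨g', hg'⟩ := hg.exists_insert h0 hu
      (le_mul_of_one_le_left hε (one_le_pow₀ (by norm_num))) (by linarith) w
    exact ⟨g', by rwa [mul_assoc]⟩

end Cocycles

end AlmostFlat


namespace AlmostFlat
set_option linter.unusedSectionVars false

/-! ### The smallest simplex containing a point. -/

section Support

variable {ι : Type*} [Fintype ι] {X : AbstractSimplicialComplex ι}

open Classical in
/-- The vertices of the smallest simplex containing a point. -/
noncomputable def supp (x : realization X) : Finset ι := Finset.univ.filter fun i => x.1 i ≠ 0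

theorem mem_supp {x : realization X} {i : ι} : i ∈ supp x ↔ x.1 i ≠ 0 := by simp [supp]

theorem supp_mem_faces (x : realization X) : supp x ∈ X.faces := by
  obtain ⟨σ, hσ, hs⟩ := x.2.2.2
  have : supp x = σ := by ext i; rw [mem_supp, hs]
  rwa [this]

theorem mem_cell_iff {x : realization X} {σ : Finset ι} : x ∈ cell X σ ↔ supp x ⊆ σ :=
  ⟨fun h _ hi => h _ (mem_supp.1 hi), fun h _ hi => h (mem_supp.2 hi)⟩

theorem mem_cell_supp (x : realization X) : x ∈ cell X (supp x) := mem_cell_iff.2 subset_rfl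

theorem nonempty_of_mem_faces {σ : Finset ι} (h : σ ∈ X.faces) : σ.Nonempty :=
  (X.isRelLowerSet_faces h).1

theorem mem_faces_of_subset {ρ σ : Finset ι} (h : σ ∈ X.faces) (hρ : ρ ⊆ σ) (hn : ρ.Nonempty) :
    ρ ∈ X.faces :=
  (X.isRelLowerSet_faces h).2 hρ hn

theorem continuous_coord (i : ι) : Continuous fun x : realization X => x.1 i := by fun_prop

theorem isOpen_setOf_coord_ne_zero (i : ι) : IsOpen {x : realization X | x.1 i ≠ 0} :=
  isOpen_ne.preimage (continuous_coord i)

open Filter Topology in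
-- Nonzero coordinates stay nonzero nearby. Hence x and any nearby y lie in the common simplex `supp
-- y`, where estimates on single simplices apply.
theorem eventually_supp_subset (x : realization X) : ∀ᶠ y in 𝓝 x, supp x ⊆ supp y := by
  have : ∀ i ∈ supp x, ∀ᶠ y : realization X in 𝓝 x, y.1 i ≠ 0 := fun i hi =>
    (isOpen_setOf_coord_ne_zero i).mem_nhds (mem_supp.1 hi)
  filter_upwards [(Filter.eventually_all_finset (supp x)).2 this] with y hy i hi
  exact mem_supp.2 (hy i hi)

variable [DecidableEq ι]

theorem supp_vertex (v : ι) : supp (vertex X v) = {v} := by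
  ext i
  simp [mem_supp, vertex]

end Support

/-! ### Products of group elements along simplicial paths. -/

section WalkProducts

variable {ι : Type*} {S : SimpleGraph ι} {G : Type*} [Group G]

/-- The product of a `G`-valued function on the edges along a walk; the factors of the later
edges stand on the left, and `f w v` belongs to the edge from `v` to `w`. -/
def walkProd (f : ι → ι → G) : ∀ {v w : ι}, S.Walk v w → G
  | _, _, .nil => 1
  | v, _, .cons (v := v') _ p => walkProd f p * f v' v

@[simp] theorem walkProd_nil (f : ι → ι → G) (v : ι) : walkProd f (.nil : S.Walk v v) = 1 := rfl

@[simp] theorem walkProd_cons (f : ι → ι → G) {v v' w : ι} (h : S.Adj v v') (p : S.Walk v' w) :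
    walkProd f (.cons h p) = walkProd f p * f v' v := rfl

theorem walkProd_append (f : ι → ι → G) {u v w : ι} (p : S.Walk u v) (q : S.Walk v w) :
    walkProd f (p.append q) = walkProd f q * walkProd f p := by
  induction p with
  | nil => simp
  | cons h p ih => simp [ih, mul_assoc]

theorem walkProd_reverse (f : ι → ι → G) (hf : ∀ v w, S.Adj v w → f v w * f w v = 1) {v w : ι}
    (p : S.Walk v w) : walkProd f p.reverse = (walkProd f p)⁻¹ := by
  induction p with
  | nil => simp
  | cons h p ih =>
    rw [SimpleGraph.Walk.reverse_cons, walkProd_append, ih, walkProd_cons, walkProd_cons,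
      mul_inv_rev]
    simp [eq_inv_of_mul_eq_one_left (hf _ _ h)]

theorem map_walkProd {H : Type*} [Group H] (φ : G →* H) (f : ι → ι → G) {v w : ι}
    (p : S.Walk v w) : φ (walkProd f p) = walkProd (fun a b => φ (f a b)) p := by
  induction p with
  | nil => simp
  | cons h p ih => simp [ih]

end WalkProducts

/-! ### Transport in a bundle, expressed by unitaries on the edges. -/

section Transport

variable {ι : Type*} [Fintype ι] {X : AbstractSimplicialComplex ι}
  {A : Type*} [NonUnitalCStarAlgebra A] [PartialOrder A] [StarOrderedRing A]
  {V : Type*} [NormedAddCommGroup V] [NormedSpace ℂ V] [SMul A V] [CStarModule A V]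

theorem norm_walkProd_sub_le {S : SimpleGraph ι} {f f' : ι → ι → unitaryGroup A V} {η : ℝ}
    (h : ∀ v w, S.Adj v w → ‖op (f w v) - op (f' w v)‖ ≤ η) {v w : ι} (p : S.Walk v w) :
    ‖op (walkProd f p) - op (walkProd f' p)‖ ≤ p.length * η := by
  induction p with
  | nil => simp
  | cons hadj p ih =>
    rw [walkProd_cons, walkProd_cons, SimpleGraph.Walk.length_cons]
    refine (norm_op_mul_sub_le _ _ _ _).trans ?_
    push_cast
    linarith [h _ _ hadj]

namespace TrivializationFamily

variable {E : HilbertModuleBundle A V (realization X)} (T : TrivializationFamily E)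

/-- The change of frames `Φ_ρ(x, ·)⁻¹ Φ_σ(x, ·)` at a common point `x` of two simplices. -/
def frameChange (ρ σ : X.faces) (x : realization X) (hρ : x ∈ cell X ρ.1) (hσ : x ∈ cell X σ.1) :
    unitaryGroup A V :=
  ⟨(T.Φ σ ⟨x, hσ⟩).trans (T.Φ ρ ⟨x, hρ⟩).symm,
    (T.isHilbertIso σ ⟨x, hσ⟩).trans (T.isHilbertIso ρ ⟨x, hρ⟩).symm⟩

theorem frameChange_mul (ρ σ τ : X.faces) (x : realization X) (hρ : x ∈ cell X ρ.1)
    (hσ : x ∈ cell X σ.1) (hτ : x ∈ cell X τ.1) :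
    T.frameChange ρ σ x hρ hσ * T.frameChange σ τ x hσ hτ = T.frameChange ρ τ x hρ hτ := by
  ext v
  exact congrArg (T.Φ ρ ⟨x, hρ⟩).symm ((T.Φ σ ⟨x, hσ⟩).apply_symm_apply _)

theorem frameChange_self (ρ : X.faces) (x : realization X) (hρ : x ∈ cell X ρ.1) :
    T.frameChange ρ ρ x hρ hρ = 1 := by
  have := T.frameChange_mul ρ ρ ρ x hρ hρ hρ
  simpa using this

theorem IsFlat.norm_frameChange_sub_le {T : TrivializationFamily E} {ε : ℝ} (h : T.IsFlat ε)
    {ρ σ : X.faces} (hρσ : ρ.1 ⊆ σ.1) {x y : realization X} (hx : x ∈ cell X ρ.1)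
    (hy : y ∈ cell X ρ.1) :
    ‖op (T.frameChange ρ σ x hx (cell_mono hρσ hx)) -
      op (T.frameChange ρ σ y hy (cell_mono hρσ hy))‖ ≤ ε * dist x y :=
  h ρ σ hρσ ⟨x, hx⟩ ⟨y, hy⟩

variable [DecidableEq ι]

variable (X) in
/-- A vertex, as a simplex of `X`. -/
def vertexFace (v : ι) : X.faces := ⟨{v}, X.singleton_mem v⟩

open Classical in
/-- Transport along the edge from `v` to `w`, with respect to the frames `Φ_{v}` and `Φ_{w}`
over the vertices; the value is `1` if there is no such edge. -/
noncomputable def edgeRep (w v : ι) : unitaryGroup A V :=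
  if h : (skeleton X).Adj v w then
    T.frameChange (vertexFace X w) ⟨{v, w}, h.2⟩ (vertex X w) (vertex_mem_cell (by simp [vertexFace]))
      (vertex_mem_cell (by simp)) *
    T.frameChange ⟨{v, w}, h.2⟩ (vertexFace X v) (vertex X v) (vertex_mem_cell (by simp))
      (vertex_mem_cell (by simp [vertexFace]))
  else 1

/-- The frame over a vertex. -/
noncomputable def vertexFrame (v : ι) : V ≃L[ℂ] E.Fiber (vertex X v) :=
  T.atVertex (vertexFace X v) v (by simp [vertexFace])

/-- The frames over intermediate vertices cancel between consecutive edges. This reduces transport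
to a product of unitaries of V. -/
theorem transport_eq {v w : ι} (p : (skeleton X).Walk v w) (x : V) :
    T.transport p (T.vertexFrame v x) = T.vertexFrame w ((walkProd T.edgeRep p).1 x) := by
  induction p generalizing x with
  | nil => rfl
  | @cons v v' w h p ih =>
    have : T.edgeTransport h (T.vertexFrame v x) = T.vertexFrame v' ((T.edgeRep v' v).1 x) := by
      rw [edgeRep, dif_pos h]
      symm
      refine ((T.vertexFrame v').apply_symm_apply _).trans ?_
      refine congrArg (T.Φ ⟨{v, v'}, h.2⟩ ⟨vertex X v', _⟩) ?_
      rfl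
    change T.transport p (T.edgeTransport h (T.vertexFrame v x)) = _
    rw [this, ih]
    rfl

theorem loopTransport_eq {x₀ : ι} (γ : (skeleton X).Walk x₀ x₀) :
    T.loopTransport γ = walkProd T.edgeRep γ := by
  ext x
  change (T.vertexFrame x₀).symm (T.transport γ (T.vertexFrame x₀ x)) = _
  rw [transport_eq, ContinuousLinearEquiv.symm_apply_apply]

end TrivializationFamily

end Transport

/-! ### The bundle glued from a Lipschitz cocycle, its flatness and its transport. -/

section Gluing

open Bundle

variable {ι : Type*} [Fintype ι] [DecidableEq ι] {X : AbstractSimplicialComplex ι}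
  {A : Type*} [NonUnitalCStarAlgebra A] [PartialOrder A] [StarOrderedRing A]
  {V : Type*} [NormedAddCommGroup V] [NormedSpace ℂ V] [SMul A V] [CStarModule A V]
  {K : ℝ} {u : ι → ι → unitaryGroup A V} {g : ι → ι → realization X → unitaryGroup A V}

/-- A vertex of the smallest simplex containing a point. -/
noncomputable def someVertex (x : realization X) : ι :=
  (nonempty_of_mem_faces (supp_mem_faces x)).choose

theorem someVertex_mem (x : realization X) : someVertex x ∈ supp x :=
  (nonempty_of_mem_faces (supp_mem_faces x)).choose_spec

theorem mem_cell_univ (x : realization X) : x ∈ cell X Finset.univ := fun _ _ => Finset.mem_univ _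

theorem someVertex_mem_of_mem_cell {x : realization X} {σ : Finset ι} (hx : x ∈ cell X σ) :
    someVertex x ∈ σ :=
  mem_cell_iff.1 hx (someVertex_mem x)

theorem IsCocycleOn.self (hg : IsCocycleOn X Finset.univ K u g) {σ : Finset ι} (hσ : σ ∈ X.faces)
    {a : ι} (ha : a ∈ σ) {x : realization X} (hx : x ∈ cell X σ) : g a a x = 1 := by
  simpa using hg.mul σ hσ a ha a ha a ha x hx (mem_cell_univ x)

theorem IsCocycleOn.inv (hg : IsCocycleOn X Finset.univ K u g) {σ : Finset ι} (hσ : σ ∈ X.faces)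
    {a b : ι} (ha : a ∈ σ) (hb : b ∈ σ) {x : realization X} (hx : x ∈ cell X σ) :
    (g a b x)⁻¹ = g b a x :=
  inv_eq_of_mul_eq_one_right (by
    rw [hg.mul σ hσ a ha b hb a ha x hx (mem_cell_univ x), hg.self hσ ha hx])

open Filter Topology in
-- The Lipschitz bound is available only inside one simplex; for y near x the simplex `supp y`
-- contains both points.
theorem IsCocycleOn.continuousOn (hg : IsCocycleOn X Finset.univ K u g) (a b : ι) :
    ContinuousOn (fun x => op (g a b x)) ({x | x.1 a ≠ 0} ∩ {x | x.1 b ≠ 0}) := by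
  rintro x ⟨ha, hb⟩
  refine ContinuousAt.continuousWithinAt ?_
  rw [ContinuousAt, tendsto_iff_norm_sub_tendsto_zero]
  have h0 : Tendsto (fun y => K * dist y x) (𝓝 x) (𝓝 0) := by
    have : Continuous fun y => K * dist y x := by fun_prop
    simpa using this.tendsto x
  refine squeeze_zero' (Eventually.of_forall fun _ => norm_nonneg _) ?_ h0
  filter_upwards [eventually_supp_subset x] with y hy
  exact hg.lipschitz (supp y) (supp_mem_faces y) a (hy (mem_supp.2 ha)) b (hy (mem_supp.2 hb))
    y (mem_cell_supp y) x (mem_cell_iff.2 hy) (mem_cell_univ y) (mem_cell_univ x)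

/-- The bundle glued from trivial bundles over the open stars of the vertices by a cocycle. -/
noncomputable def IsCocycleOn.core (hg : IsCocycleOn X Finset.univ K u g) :
    VectorBundleCore ℂ (realization X) V ι where
  baseSet i := {x | x.1 i ≠ 0}
  isOpen_baseSet := isOpen_setOf_coord_ne_zero
  indexAt := someVertex
  mem_baseSet_at x := mem_supp.1 (someVertex_mem x)
  coordChange i j x := op (g j i x)
  coordChange_self i x hx v := by
    rw [hg.self (supp_mem_faces x) (mem_supp.2 hx) (mem_cell_supp x)]; rfl
  continuousOn_coordChange i j := by
    rw [Set.inter_comm]; exact hg.continuousOn j i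
  coordChange_comp i j k x hx v := by
    rw [← hg.mul (supp x) (supp_mem_faces x) k (mem_supp.2 hx.2) j (mem_supp.2 hx.1.2) i
      (mem_supp.2 hx.1.1) x (mem_cell_supp x) (mem_cell_univ x)]
    rfl

/-- The Hilbert module bundle glued by a cocycle of unitaries. -/
noncomputable def IsCocycleOn.bundle (hg : IsCocycleOn X Finset.univ K u g) :
    HilbertModuleBundle A V (realization X) where
  Fiber := hg.core.Fiber
  smul _ := inferInstanceAs (SMul A V)
  inner _ := inferInstanceAs (Inner A V)
  isHilbertIso := by
    rintro e ⟨⟨i, rfl⟩⟩ b hb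
    exact (g i (someVertex b) b).2

/-- A vertex of a simplex. -/
noncomputable def faceVertex (σ : X.faces) : ι := (nonempty_of_mem_faces σ.2).choose

theorem faceVertex_mem (σ : X.faces) : faceVertex σ ∈ σ.1 :=
  (nonempty_of_mem_faces σ.2).choose_spec

/-- Over a simplex `σ`, the glued bundle is trivialized by the frame of a vertex of `σ`. -/
noncomputable def IsCocycleOn.trivializationFamily (hg : IsCocycleOn X Finset.univ K u g) :
    TrivializationFamily hg.bundle where
  Φ σ x := (g (someVertex x.1) (faceVertex σ) x.1).1
  isHilbertIso σ x := (g (someVertex x.1) (faceVertex σ) x.1).2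
  continuousOn := by
    rintro σ e ⟨⟨i, rfl⟩⟩
    have hc : ContinuousOn (fun x : cell X σ.1 => op (g i (faceVertex σ) x.1))
        {x | x.1.1 i ≠ 0} := by
      intro x hx
      have hl : LipschitzOnWith (Real.toNNReal K)
          (fun x : cell X σ.1 => op (g i (faceVertex σ) x.1)) {x | x.1.1 i ≠ 0} := by
        refine LipschitzOnWith.of_dist_le_mul fun y hy z hz => ?_
        rw [dist_eq_norm]
        refine (hg.lipschitz σ.1 σ.2 i (y.2 i hy) _ (faceVertex_mem σ) y y.2 z z.2
          (mem_cell_univ _) (mem_cell_univ _)).trans ?_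
        exact mul_le_mul_of_nonneg_right (Real.le_coe_toNNReal K) dist_nonneg
      exact hl.continuousOn x hx
    refine hc.congr fun x hx => ?_
    have hi : i ∈ supp x.1 := mem_supp.2 hx
    have hs : supp x.1 ⊆ σ.1 := mem_cell_iff.1 x.2
    have h1 := hg.core.localTriv_continuousLinearMapAt (i := i) (b := x.1) hx
    refine (congrArg (fun f : V →L[ℂ] V =>
      f.comp (op (g (someVertex x.1) (faceVertex σ) x.1))) h1).trans ?_
    exact congrArg op (hg.mul σ.1 σ.2 i (hs hi) (someVertex x.1) (hs (someVertex_mem _))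
      (faceVertex σ) (faceVertex_mem σ) x.1 x.2 (mem_cell_univ _))

/-- The fibre over x is written in the frame of `someVertex x`; this arbitrary choice cancels by the
cocycle identity, leaving a Lipschitz function. -/
theorem IsCocycleOn.frameChange_eq (hg : IsCocycleOn X Finset.univ K u g) (ρ σ τ : X.faces)
    (hρτ : ρ.1 ⊆ τ.1) (hστ : σ.1 ⊆ τ.1) (x : realization X) (hρ : x ∈ cell X ρ.1)
    (hσ : x ∈ cell X σ.1) :
    hg.trivializationFamily.frameChange ρ σ x hρ hσ = g (faceVertex ρ) (faceVertex σ) x := by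
  have h1 := hg.mul τ.1 τ.2 _ (hρτ (faceVertex_mem ρ)) (someVertex x)
    (hρτ (someVertex_mem_of_mem_cell hρ)) _ (hστ (faceVertex_mem σ)) x (cell_mono hρτ hρ)
    (mem_cell_univ x)
  rw [← h1, ← hg.inv τ.2 (hρτ (someVertex_mem_of_mem_cell hρ)) (hρτ (faceVertex_mem ρ))
    (cell_mono hρτ hρ)]
  rfl

theorem IsCocycleOn.isFlat (hg : IsCocycleOn X Finset.univ K u g) :
    hg.trivializationFamily.IsFlat K := fun ρ σ h x y => by
  have hx := hg.frameChange_eq ρ σ σ h subset_rfl x.1 x.2 (cell_mono h x.2)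
  have hy := hg.frameChange_eq ρ σ σ h subset_rfl y.1 y.2 (cell_mono h y.2)
  have := hg.lipschitz σ.1 σ.2 _ (h (faceVertex_mem ρ)) _ (faceVertex_mem σ) x.1
    (cell_mono h x.2) y.1 (cell_mono h y.2) (mem_cell_univ _) (mem_cell_univ _)
  rw [← hx, ← hy] at this
  exact this

/-- With m the vertex chosen to frame the edge, the transport is g w m at w times g m v at v.
Replacing both factors by values of u costs 2 K, and composing those costs ε. -/
theorem IsCocycleOn.norm_edgeRep_sub_le (hg : IsCocycleOn X Finset.univ K u g) {ε : ℝ}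
    (hu : IsAlmostCocycle X ε u) {v w : ι} (h : (skeleton X).Adj v w) :
    ‖op (hg.trivializationFamily.edgeRep w v) - op (u w v)‖ ≤ 2 * K + 2 * ε := by
  have hfv : ∀ v, faceVertex (TrivializationFamily.vertexFace X v) = v := fun v =>
    Finset.mem_singleton.1 (faceVertex_mem (TrivializationFamily.vertexFace X v))
  have hv : v ∈ ({v, w} : Finset ι) := by simp
  have hw : w ∈ ({v, w} : Finset ι) := by simp
  have hvs : ({v} : Finset ι) ⊆ {v, w} := by simp
  have hws : ({w} : Finset ι) ⊆ {v, w} := by simp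
  have hm := faceVertex_mem (⟨{v, w}, h.2⟩ : X.faces)
  set m := faceVertex (⟨{v, w}, h.2⟩ : X.faces) with hm_def
  rw [TrivializationFamily.edgeRep, dif_pos h,
    hg.frameChange_eq _ _ ⟨{v, w}, h.2⟩ hws subset_rfl,
    hg.frameChange_eq _ _ ⟨{v, w}, h.2⟩ subset_rfl hvs, hfv, hfv, ← hm_def]
  have h1 := norm_op_mul_sub_le (g w m (vertex X w)) (g m v (vertex X v)) (u w m) (u m v)
  have h2 := hg.close _ h.2 w hw m hm _ (vertex_mem_cell hw) (mem_cell_univ _)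
  have h3 := hg.close _ h.2 m hm v hv _ (vertex_mem_cell hv) (mem_cell_univ _)
  have h4 := hu _ h.2 w hw m hm v hv
  have h0 : 0 ≤ ε := (norm_nonneg _).trans h4
  have h5 := norm_sub_le_norm_sub_add_norm_sub
    (op (g w m (vertex X w) * g m v (vertex X v))) (op (u w m * u m v)) (op (u w v))
  linarith

end Gluing

end AlmostFlat


namespace AlmostFlat
set_option linter.unusedSectionVars false

/-! ### Error bounds for words, uniform in the C*-algebra and the module. -/

section NormalClosure

/-- N counts the conjugates of relators and their inverses in a fixed expression of n. It is found
before the length l is given, and so serves all modules at once. -/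
theorem exists_bound_of_mem_normalClosure {F : Type*} [Group F] {R : Set F} {n : F}
    (hn : n ∈ Subgroup.normalClosure R) : ∃ N : ℕ, ∀ (l : F → ℝ) (ε : ℝ), l 1 = 0 →
      (∀ x y, l (x * y) ≤ l x + l y) → (∀ x, l x⁻¹ = l x) → (∀ x y, l (x * y * x⁻¹) = l y) →
      (∀ r ∈ R, l r ≤ ε) → l n ≤ N * ε := by
  induction hn using Subgroup.closure_induction with
  | mem x hx =>
    refine ⟨1, fun l ε _ _ _ hc hR => ?_⟩
    obtain ⟨r, hr, hx⟩ := Group.mem_conjugatesOfSet_iff.1 hx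
    obtain ⟨c, rfl⟩ := isConj_iff.1 hx
    rw [hc, Nat.cast_one, one_mul]
    exact hR r hr
  | one => exact ⟨0, fun l ε h _ _ _ _ => by simp [h]⟩
  | mul x y _ _ hx hy =>
    obtain ⟨N, hN⟩ := hx
    obtain ⟨M, hM⟩ := hy
    refine ⟨N + M, fun l ε h1 hm hi hc hR => (hm x y).trans ?_⟩
    push_cast
    linarith [hN l ε h1 hm hi hc hR, hM l ε h1 hm hi hc hR]
  | inv x _ hx =>
    obtain ⟨N, hN⟩ := hx
    exact ⟨N, fun l ε h1 hm hi hc hR => by rw [hi]; exact hN l ε h1 hm hi hc hR⟩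


/-- Elements of the normal closure of the relations act almost trivially in almost
representations. -/
theorem exists_norm_op_sub_one_le {F : Type*} [Group F] {R : Set F} {n : F}
    (hn : n ∈ Subgroup.normalClosure R) : ∃ N : ℕ,
      ∀ (A : Type u) [NonUnitalCStarAlgebra A] [PartialOrder A] [StarOrderedRing A]
        (V : Type v) [NormedAddCommGroup V] [NormedSpace ℂ V] [SMul A V] [CStarModule A V]
        (φ : F →* unitaryGroup A V) (ε : ℝ), (∀ r ∈ R, ‖op (φ r) - 1‖ ≤ ε) →
        ‖op (φ n) - 1‖ ≤ N * ε := by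
  obtain ⟨N, hN⟩ := exists_bound_of_mem_normalClosure hn
  refine ⟨N, fun A _ _ _ V _ _ _ _ φ ε hR => ?_⟩
  refine hN (fun x => ‖op (φ x) - 1‖) ε (by simp) (fun x y => ?_) (fun x => ?_) (fun x y => ?_) hR
  · have := norm_op_mul_sub_le (φ x) (φ y) 1 1
    simpa using this
  · have := norm_op_inv_sub (φ x) 1
    simpa using this
  · have h1 := norm_op_mul_right_sub (φ x)⁻¹ (φ x * φ y) (φ x)
    have h2 := norm_op_mul_left_sub (φ x) (φ y) 1
    simp only [mul_one, map_one, mul_inv_cancel] at h1 h2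
    simp only [map_mul φ, map_inv φ]
    rw [h1, h2]

/-- Each letter contributes at most δ, so the length of a word serves as N. -/
theorem exists_norm_freeGroup_sub_le {L : Type*} (s : FreeGroup L) : ∃ N : ℕ,
      ∀ (A : Type u) [NonUnitalCStarAlgebra A] [PartialOrder A] [StarOrderedRing A]
        (V : Type v) [NormedAddCommGroup V] [NormedSpace ℂ V] [SMul A V] [CStarModule A V]
        (φ ψ : FreeGroup L →* unitaryGroup A V) (δ : ℝ),
        (∀ g, ‖op (φ (.of g)) - op (ψ (.of g))‖ ≤ δ) → ‖op (φ s) - op (ψ s)‖ ≤ N * δ := by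
  induction s using FreeGroup.induction_on with
  | C1 => exact ⟨0, fun A _ _ _ V _ _ _ _ φ ψ δ _ => by simp⟩
  | of g => exact ⟨1, fun A _ _ _ V _ _ _ _ φ ψ δ h => by simpa using h g⟩
  | inv_of g h =>
    obtain ⟨N, hN⟩ := h
    refine ⟨N, fun A _ _ _ V _ _ _ _ φ ψ δ h => ?_⟩
    have := hN A V φ ψ δ h
    rw [map_inv φ, map_inv ψ, norm_op_inv_sub]
    exact this
  | mul x y hx hy =>
    obtain ⟨N, hN⟩ := hx
    obtain ⟨M, hM⟩ := hy
    refine ⟨N + M, fun A _ _ _ V _ _ _ _ φ ψ δ h => ?_⟩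
    rw [map_mul φ, map_mul ψ]
    refine (norm_op_mul_sub_le _ _ _ _).trans ?_
    push_cast
    linarith [hN A V φ ψ δ h, hM A V φ ψ δ h]

end NormalClosure

/-! ### The cocycle on the edges with values in the fundamental group. -/

section EdgeClasses

variable {ι : Type*} [Fintype ι] {X : AbstractSimplicialComplex ι}

/-- Two paths with the same end points inside one simplex are homotopic. -/
theorem homotopic_of_mem_cell {σ : Finset ι} (hσ : σ ∈ X.faces) {a b : realization X}
    (p q : Path a b) (hp : ∀ t, p t ∈ cell X σ) (hq : ∀ t, q t ∈ cell X σ) :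
    Path.Homotopic p q := by
  have hmem : ∀ s t : unitInterval, (1 - (s : ℝ)) • (p t).1 + (s : ℝ) • (q t).1 ∈
      realization X := fun s t => by
    refine mem_realization hσ (fun i => ?_) ?_ (fun i hi => ?_)
    · have h1 := (p t).2.1 i
      have h2 := (q t).2.1 i
      have h3 := sub_nonneg.2 s.2.2
      have h4 := s.2.1
      simp only [PiLp.add_apply, PiLp.smul_apply, smul_eq_mul]
      positivity
    · simp only [PiLp.add_apply, PiLp.smul_apply, smul_eq_mul, Finset.sum_add_distrib,
        ← Finset.mul_sum, (p t).2.2.1, (q t).2.2.1]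
      ring
    · by_contra hn
      have h1 : (p t).1 i = 0 := not_not.1 fun h => hn (hp t i h)
      have h2 : (q t).1 i = 0 := not_not.1 fun h => hn (hq t i h)
      exact hi (by simp [h1, h2])
  refine ⟨{ toFun := fun z => ⟨_, hmem z.1 z.2⟩
            continuous_toFun := ?_
            map_zero_left := fun t => ?_
            map_one_left := fun t => ?_
            prop' := fun s t ht => ?_ }⟩
  · refine Continuous.subtype_mk ?_ _
    fun_prop
  · apply Subtype.ext; simp
  · apply Subtype.ext; simp
  · apply Subtype.ext
    rcases ht with rfl | rfl
    · simp [← add_smul]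
    · simp [← add_smul]

variable [DecidableEq ι]

open CategoryTheory

/-- The straight path between two vertices of a simplex. -/
noncomputable def segPath {v w : ι} (h : ({v, w} : Finset ι) ∈ X.faces) :
    Path (vertex X v) (vertex X w) where
  toFun t := ⟨(1 - (t : ℝ)) • EuclideanSpace.single v 1 + (t : ℝ) • EuclideanSpace.single w 1,
    mem_realization h
      (fun i => by
        have h0 := t.2.1
        have h1 := sub_nonneg.2 t.2.2
        simp only [PiLp.add_apply, PiLp.smul_apply, PiLp.single_apply, smul_eq_mul]
        split_ifs <;> simp [h0, t.2.2])
      (by simp [Finset.sum_add_distrib])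
      (fun i hi => by
        by_contra hne
        simp only [Finset.mem_insert, Finset.mem_singleton, not_or] at hne
        exact hi (by simp [hne.1, hne.2]))⟩
  continuous_toFun := by
    refine Continuous.subtype_mk ?_ _
    fun_prop
  source' := by simp [vertex]
  target' := by simp [vertex]

theorem segPath_mem_cell {v w : ι} (h : ({v, w} : Finset ι) ∈ X.faces) {σ : Finset ι}
    (hv : v ∈ σ) (hw : w ∈ σ) (t : unitInterval) : segPath h t ∈ cell X σ := by
  intro i hi
  by_contra hne
  have h1 : i ≠ v := fun e => hne (e ▸ hv)
  have h2 : i ≠ w := fun e => hne (e ▸ hw)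
  have h3 : ((1 - (t : ℝ)) • EuclideanSpace.single v (1 : ℝ) +
      (t : ℝ) • EuclideanSpace.single w (1 : ℝ)) i = 0 := by simp [h1, h2]
  exact hi h3

variable (X) in
/-- A vertex, as an object of the fundamental groupoid. -/
noncomputable abbrev vertexObj (v : ι) : FundamentalGroupoid (realization X) := ⟨vertex X v⟩

/-- The class of a path between two vertices in the fundamental groupoid. -/
noncomputable def pathArrow {v w : ι} (p : Path (vertex X v) (vertex X w)) :
    vertexObj X v ⟶ vertexObj X w :=
  Path.Homotopic.Quotient.mk p

theorem pathArrow_trans {u v w : ι} (p : Path (vertex X u) (vertex X v))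
    (q : Path (vertex X v) (vertex X w)) : pathArrow (p.trans q) = pathArrow p ≫ pathArrow q := rfl

/-- Both sides are paths in the convex set |σ|. -/
theorem pathArrow_segPath_comp {σ : Finset ι} (hσ : σ ∈ X.faces) {a b c : ι} (ha : a ∈ σ)
    (hb : b ∈ σ) (hc : c ∈ σ) (hab : ({a, b} : Finset ι) ∈ X.faces)
    (hbc : ({b, c} : Finset ι) ∈ X.faces) (hac : ({a, c} : Finset ι) ∈ X.faces) :
    pathArrow (segPath hab) ≫ pathArrow (segPath hbc) = pathArrow (segPath hac) := by
  rw [← pathArrow_trans]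
  refine Path.Homotopic.Quotient.eq.2 (homotopic_of_mem_cell hσ _ _ (fun t => ?_)
    (segPath_mem_cell hac ha hc))
  have : (segPath hab).trans (segPath hbc) t ∈ Set.range ((segPath hab).trans (segPath hbc)) :=
    ⟨t, rfl⟩
  rw [Path.trans_range] at this
  rcases this with ⟨s, hs⟩ | ⟨s, hs⟩
  · rw [← hs]; exact segPath_mem_cell hab ha hb s
  · rw [← hs]; exact segPath_mem_cell hbc hb hc s

theorem pair_mem_faces {σ : Finset ι} (hσ : σ ∈ X.faces) {a b : ι} (ha : a ∈ σ) (hb : b ∈ σ) :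
    ({a, b} : Finset ι) ∈ X.faces :=
  mem_faces_of_subset hσ (by simp [Finset.insert_subset_iff, ha, hb]) (by simp)

theorem adj_or_eq_of_mem_faces {σ : Finset ι} (hσ : σ ∈ X.faces) {a b : ι} (ha : a ∈ σ)
    (hb : b ∈ σ) : a = b ∨ (skeleton X).Adj a b := by
  by_cases h : a = b
  · exact Or.inl h
  · exact Or.inr ⟨h, pair_mem_faces hσ ha hb⟩

theorem reachable_of_mem_faces {σ : Finset ι} (hσ : σ ∈ X.faces) {a b : ι} (ha : a ∈ σ)
    (hb : b ∈ σ) : (skeleton X).Reachable a b := by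
  rcases adj_or_eq_of_mem_faces hσ ha hb with rfl | h
  · exact SimpleGraph.Reachable.refl _
  · exact h.reachable

/-- The fundamental group carries a cocycle on the edges of `X` such that the class of a simplicial
loop is the product of the values on its edges. -/
theorem exists_edgeClass (x₀ : ι) :
    ∃ χ : ι → ι → FundamentalGroup (realization X) (vertex X x₀),
      (∀ σ ∈ X.faces, ∀ a ∈ σ, ∀ b ∈ σ, ∀ c ∈ σ, χ a b * χ b c = χ a c) ∧
      ∀ γ : (skeleton X).Walk x₀ x₀, walkProd χ γ = loopClass γ := by
  classical
  let P₀ : ∀ v, (skeleton X).Reachable x₀ v → (vertexObj X x₀ ⟶ vertexObj X v) :=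
    fun v h => pathArrow (walkPath h.some)
  -- The path chosen from x₀ to itself may be essential. Dividing by it makes P trivial at x₀;
  -- otherwise products along loops would only be conjugate to their classes.
  let P : ∀ v, (skeleton X).Reachable x₀ v → (vertexObj X x₀ ⟶ vertexObj X v) :=
    fun v h => Groupoid.inv (P₀ x₀ (.refl _)) ≫ P₀ v h
  have hP : P x₀ (.refl _) = 𝟙 _ := Groupoid.inv_comp _
  -- The loop runs from x₀ to b, along the edge to a, and back, in accordance with the order of the
  -- product in π₁. The value 1 off the component of x₀ respects the cocycle identity, since all
  -- vertices of a simplex lie in one component.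
  let χ : ι → ι → FundamentalGroup (realization X) (vertex X x₀) := fun a b =>
    if h : (skeleton X).Reachable x₀ a ∧ (skeleton X).Reachable x₀ b ∧
      ({b, a} : Finset ι) ∈ X.faces then
    (P b h.2.1 ≫ pathArrow (segPath h.2.2) ≫ Groupoid.inv (P a h.1) : vertexObj X x₀ ⟶ _) else 1
  have hχ : ∀ a b (ha : (skeleton X).Reachable x₀ a) (hb : (skeleton X).Reachable x₀ b)
      (hab : ({b, a} : Finset ι) ∈ X.faces), χ a b =
      (P b hb ≫ pathArrow (segPath hab) ≫ Groupoid.inv (P a ha) : vertexObj X x₀ ⟶ _) :=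
    fun a b ha hb hab => dif_pos ⟨ha, hb, hab⟩
  have hmul : ∀ p q : FundamentalGroup (realization X) (vertex X x₀),
      p * q = ((q : vertexObj X x₀ ⟶ vertexObj X x₀) ≫ p : vertexObj X x₀ ⟶ _) := fun _ _ => rfl
  refine ⟨χ, fun σ hσ a ha b hb c hc => ?_, ?_⟩
  · by_cases h : (skeleton X).Reachable x₀ a
    · have hb' := h.trans (reachable_of_mem_faces hσ ha hb)
      have hc' := h.trans (reachable_of_mem_faces hσ ha hc)
      rw [hχ a b h hb' (pair_mem_faces hσ hb ha), hχ b c hb' hc' (pair_mem_faces hσ hc hb),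
        hχ a c h hc' (pair_mem_faces hσ hc ha), hmul,
        ← pathArrow_segPath_comp hσ hc hb ha (pair_mem_faces hσ hc hb) (pair_mem_faces hσ hb ha)]
      simp only [Category.assoc]
      rw [← Category.assoc (Groupoid.inv (P b hb')), Groupoid.inv_comp, Category.id_comp]
    · have hn : ∀ b c, b ∈ σ → χ b c = 1 := fun b c hb => dif_neg fun h' =>
        h (h'.1.trans (reachable_of_mem_faces hσ hb ha))
      rw [hn a b ha, hn b c hb, hn a c ha, one_mul]
  · have key : ∀ {v w : ι} (p : (skeleton X).Walk v w) (hv : (skeleton X).Reachable x₀ v)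
        (hw : (skeleton X).Reachable x₀ w), walkProd χ p =
        (P v hv ≫ pathArrow (walkPath p) ≫ Groupoid.inv (P w hw) : vertexObj X x₀ ⟶ _) := by
      intro v w p
      induction p with
      | nil =>
        intro hv hw
        change (1 : FundamentalGroup _ _) = P _ hv ≫ 𝟙 _ ≫ Groupoid.inv (P _ hw)
        rw [Category.id_comp, Groupoid.comp_inv]
        rfl
      | @cons v v' w h p ih =>
        intro hv hw
        have hv' := hv.trans h.reachable
        rw [walkProd_cons, ih hv' hw, hχ v' v hv' hv h.2, hmul]
        change _ = P v hv ≫ (pathArrow (segPath h.2) ≫ pathArrow (walkPath p)) ≫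
          Groupoid.inv (P w hw)
        simp only [Category.assoc]
        rw [← Category.assoc (Groupoid.inv (P v' hv')), Groupoid.inv_comp, Category.id_comp]
    intro γ
    rw [key γ (.refl _) (.refl _), hP]
    have : Groupoid.inv (𝟙 (vertexObj X x₀)) = 𝟙 _ := by
      rw [← Category.id_comp (Groupoid.inv _), Groupoid.comp_inv]
    rw [this, Category.id_comp, Category.comp_id]
    rfl

end EdgeClasses

end AlmostFlat


namespace AlmostFlat
set_option linter.unusedSectionVars false

/-! ### Cocycles with values in a discrete group, and monodromy of the associated covering. -/

section Covering

open Bundle Topology Filter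

variable {ι : Type*} [Fintype ι] [DecidableEq ι] {X : AbstractSimplicialComplex ι}
  {G : Type*} [Group G]

variable (X) in
/-- A cocycle on the edges of `X` with values in a group. -/
def IsCocycle (f : ι → ι → G) : Prop :=
  ∀ σ ∈ X.faces, ∀ a ∈ σ, ∀ b ∈ σ, ∀ c ∈ σ, f a b * f b c = f a c

theorem IsCocycle.self {f : ι → ι → G} (hf : IsCocycle X f) (v : ι) : f v v = 1 := by
  have hv := Finset.mem_singleton_self v
  simpa using hf _ (X.singleton_mem v) v hv v hv v hv

theorem someVertex_vertex (v : ι) : someVertex (vertex X v) = v := by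
  have := someVertex_mem (vertex X v)
  rwa [supp_vertex, Finset.mem_singleton] at this

variable [TopologicalSpace G] [DiscreteTopology G]

/-- The principal bundle with discrete fibre glued by a cocycle. -/
noncomputable def IsCocycle.core {f : ι → ι → G} (hf : IsCocycle X f) :
    FiberBundleCore ι (realization X) G where
  baseSet i := {x | x.1 i ≠ 0}
  isOpen_baseSet := isOpen_setOf_coord_ne_zero
  indexAt := someVertex
  mem_baseSet_at x := mem_supp.1 (someVertex_mem x)
  coordChange i j _ g := f j i * g
  coordChange_self i x _ g := by rw [hf.self, one_mul]
  continuousOn_coordChange i j :=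
    ((continuous_of_discreteTopology (f := fun g : G => f j i * g)).comp
      continuous_snd).continuousOn
  coordChange_comp i j k x hx g := by
    rw [← mul_assoc, hf (supp x) (supp_mem_faces x) k (mem_supp.2 hx.2) j (mem_supp.2 hx.1.2) i
      (mem_supp.2 hx.1.1)]

theorem IsCocycle.isCoveringMap {f : ι → ι → G} (hf : IsCocycle X f) :
    IsCoveringMap (TotalSpace.proj : TotalSpace G hf.core.Fiber → realization X) :=
  FiberBundle.isCoveringMap

/-- The flat section over a simplex with value `g` in the frame of the vertex `v`. -/
noncomputable def IsCocycle.flatSection {f : ι → ι → G} (hf : IsCocycle X f) (v : ι) (g : G)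
    (x : realization X) : TotalSpace G hf.core.Fiber :=
  ⟨x, f (someVertex x) v * g⟩

/-- In the local trivialization at x, the cocycle identity makes the section constant near x. -/
theorem IsCocycle.continuous_flatSection {f : ι → ι → G} (hf : IsCocycle X f) {σ : Finset ι}
    (hσ : σ ∈ X.faces) {v : ι} (hv : v ∈ σ) (g : G) :
    Continuous fun x : cell X σ => hf.flatSection v g x.1 := by
  refine continuous_iff_continuousAt.2 fun x => ?_
  refine (FiberBundle.continuousAt_totalSpace G _).2 ⟨continuous_subtype_val.continuousAt, ?_⟩
  have hi := someVertex_mem x.1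
  have h : ∀ᶠ y : cell X σ in 𝓝 x, f (someVertex x.1) v * g =
      (trivializationAt G hf.core.Fiber x.1 (hf.flatSection v g y.1)).2 := by
    filter_upwards [continuous_subtype_val.continuousAt.eventually (eventually_supp_subset x.1)]
      with y hy
    change _ = f (someVertex x.1) (someVertex y.1) * (f (someVertex y.1) v * g)
    have hyσ := mem_cell_iff.1 y.2
    rw [← mul_assoc, hf σ hσ _ (hyσ (hy hi)) _ (hyσ (someVertex_mem y.1)) v hv]
  exact continuousAt_const.congr h

theorem IsCocycle.flatSection_vertex {f : ι → ι → G} (hf : IsCocycle X f) (v w : ι) (g : G) :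
    hf.flatSection v g (vertex X w) = ⟨vertex X w, f w v * g⟩ := by
  rw [flatSection, someVertex_vertex]

/-- The flat section over the edge lifts the edge path; its end points can be read off. -/
theorem IsCocycle.monodromy_edgePath {f : ι → ι → G} (hf : IsCocycle X f) {v w : ι}
    (h : (skeleton X).Adj v w) (g : G) :
    hf.isCoveringMap.monodromy (Path.Homotopic.Quotient.mk (edgePath h)) ⟨⟨vertex X v, g⟩, rfl⟩ =
      ⟨⟨vertex X w, f w v * g⟩, rfl⟩ := by
  have hv : v ∈ ({v, w} : Finset ι) := by simp
  have hw : w ∈ ({v, w} : Finset ι) := by simp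
  have hcell := segPath_mem_cell h.2 hv hw
  let p : Path (⟨vertex X v, g⟩ : TotalSpace G hf.core.Fiber) ⟨vertex X w, f w v * g⟩ :=
    { toFun := fun t => hf.flatSection v g (edgePath h t)
      continuous_toFun := (hf.continuous_flatSection h.2 hv g).comp
        (f := fun t => (⟨edgePath h t, hcell t⟩ : cell X {v, w})) (by fun_prop)
      source' := by rw [(edgePath h).source, flatSection_vertex, hf.self, one_mul]
      target' := by rw [(edgePath h).target, flatSection_vertex] }
  refine hf.isCoveringMap.monodromy_eq_of_map_eq (Path.Homotopic.Quotient.mk p) ?_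
  rfl

theorem IsCocycle.monodromy_walkPath {f : ι → ι → G} (hf : IsCocycle X f) {v w : ι}
    (p : (skeleton X).Walk v w) (g : G) :
    hf.isCoveringMap.monodromy (Path.Homotopic.Quotient.mk (walkPath p)) ⟨⟨vertex X v, g⟩, rfl⟩ =
      ⟨⟨vertex X w, walkProd f p * g⟩, rfl⟩ := by
  induction p generalizing g with
  | nil =>
    change hf.isCoveringMap.monodromy (.refl _) _ = _
    rw [hf.isCoveringMap.monodromy_refl, walkProd_nil, one_mul, id]
  | cons h p ih =>
    change hf.isCoveringMap.monodromy
      ((Path.Homotopic.Quotient.mk (edgePath h)).trans (Path.Homotopic.Quotient.mk (walkPath p))) _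
        = _
    rw [hf.isCoveringMap.monodromy_trans_apply, hf.monodromy_edgePath, ih, walkProd_cons, mul_assoc]

end Covering

/-! ### Homotopy invariance of cocycle products along loops. -/

section LoopClasses

open Bundle

variable {ι : Type*} [Fintype ι] [DecidableEq ι] {X : AbstractSimplicialComplex ι} {x₀ : ι}
  {G : Type*} [Group G]

/-- The product of a cocycle along a simplicial loop depends only on the class of the loop in the
fundamental group. -/
theorem IsCocycle.walkProd_eq {f : ι → ι → G} (hf : IsCocycle X f) {γ γ' : (skeleton X).Walk x₀ x₀} (h : loopClass γ = loopClass γ') :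
    walkProd f γ = walkProd f γ' := by
  -- With discrete G the glued bundle is a covering, and its monodromy depends only on the homotopy
  -- class of a path.
  let _ : TopologicalSpace G := ⊥
  have : DiscreteTopology G := ⟨rfl⟩
  have h1 := hf.monodromy_walkPath γ 1
  have h2 := hf.monodromy_walkPath γ' 1
  have h3 : (Path.Homotopic.Quotient.mk (walkPath γ)) =
    Path.Homotopic.Quotient.mk (walkPath γ') := h
  rw [h3, h2] at h1
  have h4 := congrArg Subtype.val h1
  have h5 : walkProd f γ' * 1 = walkProd f γ * 1 := eq_of_heq (TotalSpace.mk.inj h4).2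
  simpa using h5.symm

theorem IsCocycle.mul_swap {f : ι → ι → G} (hf : IsCocycle X f) {v w : ι}
    (h : (skeleton X).Adj v w) : f v w * f w v = 1 := by
  rw [hf _ h.2 v (by simp) w (by simp) v (by simp), hf.self]

/-- Concatenating and reversing the Γ g realizes a word by an actual simplicial loop, to which
`IsCocycle.walkProd_eq` applies. -/
theorem exists_walk_of_word {f : ι → ι → G} (hf : IsCocycle X f) {L : Type*}
    (Γ : L → (skeleton X).Walk x₀ x₀) (s : FreeGroup L) :
    ∃ γ : (skeleton X).Walk x₀ x₀, loopClass γ = FreeGroup.lift (fun g => loopClass (Γ g)) s ∧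
      walkProd f γ = FreeGroup.lift (fun g => walkProd f (Γ g)) s := by
  obtain ⟨χ, hχ, hχl⟩ := exists_edgeClass (X := X) x₀
  induction s using FreeGroup.induction_on with
  | C1 => exact ⟨.nil, by rw [← hχl, map_one, walkProd_nil], by rw [map_one, walkProd_nil]⟩
  | of g => exact ⟨Γ g, by simp, by simp⟩
  | inv_of g h =>
    refine ⟨(Γ g).reverse, ?_, ?_⟩
    · rw [← hχl, walkProd_reverse _ (fun _ _ => IsCocycle.mul_swap hχ), hχl, map_inv, FreeGroup.lift_apply_of]
    · rw [walkProd_reverse _ (fun _ _ => hf.mul_swap), map_inv, FreeGroup.lift_apply_of]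
  | mul x y hx hy =>
    obtain ⟨p, hp, hp'⟩ := hx
    obtain ⟨q, hq, hq'⟩ := hy
    refine ⟨q.append p, ?_, ?_⟩
    · rw [← hχl, walkProd_append, hχl, hχl, hp, hq, map_mul]
    · rw [walkProd_append, hp', hq', map_mul]

end LoopClasses

end AlmostFlat


namespace AlmostFlat
set_option linter.unusedSectionVars false

/-! ### Almost flat bundles from almost representations. -/

section Existence


theorem exists_bound_of_finite {κ : Type*} [Finite κ] {P : κ → ℕ → Prop}
    (hP : ∀ i m n, m ≤ n → P i m → P i n) (h : ∀ i, ∃ n, P i n) : ∃ n, ∀ i, P i n := by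
  cases nonempty_fintype κ
  choose n hn using h
  exact ⟨∑ i, n i, fun i => hP i _ _ (Finset.single_le_sum (fun _ _ => Nat.zero_le _)
    (Finset.mem_univ i)) (hn i)⟩

theorem IsPresentation.exists_lift_eq {G : Type*} [Group G] {L : Set G} {R : Set (FreeGroup L)}
    (hP : IsPresentation L R) (x : G) : ∃ s, FreeGroup.lift (fun g : L => (g : G)) s = x := by
  have h : (FreeGroup.lift (fun g : L => (g : G))).range = ⊤ := by
    rw [FreeGroup.range_lift_eq_closure, Subtype.range_coe, hP.1]
  exact MonoidHom.range_eq_top.1 h x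

/-- Words representing the same element have nearby values in every almost representation. -/
theorem IsPresentation.exists_norm_sub_le {G : Type*} [Group G] {L : Set G}
    {R : Set (FreeGroup L)} (hP : IsPresentation L R) {s t : FreeGroup L}
    (h : FreeGroup.lift (fun g : L => (g : G)) s = FreeGroup.lift (fun g : L => (g : G)) t) :
    ∃ N : ℕ, ∀ (A : Type u) [NonUnitalCStarAlgebra A] [PartialOrder A] [StarOrderedRing A]
        (V : Type v) [NormedAddCommGroup V] [NormedSpace ℂ V] [SMul A V] [CStarModule A V]
        (φ : FreeGroup L →* unitaryGroup A V) (ε : ℝ), IsAlmostRep R ε φ →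
        ‖op (φ s) - op (φ t)‖ ≤ N * ε := by
  have hn : s * t⁻¹ ∈ Subgroup.normalClosure R := by
    rw [← hP.2, MonoidHom.mem_ker, map_mul, map_inv, h, mul_inv_cancel]
  obtain ⟨N, hN⟩ := exists_norm_op_sub_one_le hn
  refine ⟨N, fun A _ _ _ V _ _ _ _ φ ε hφ => ?_⟩
  have h1 := hN A V φ ε fun r hr => (hφ r hr).le
  have h2 := norm_op_mul_right_sub (φ t) (φ (s * t⁻¹)) 1
  rw [← map_mul φ, inv_mul_cancel_right, one_mul, map_one] at h2
  rwa [h2]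

variable {ι : Type u₀} [Fintype ι] [DecidableEq ι] {X : AbstractSimplicialComplex ι} {x₀ : ι}

/-- Every almost representation of the fundamental group is close to the holonomy of an almost flat
bundle. -/
theorem exists_almostFlat_bundle
    {L : Set (FundamentalGroup (realization X) (vertex X x₀))} (hL : L.Finite)
    {R : Set (FreeGroup L)} (hR : R.Finite) (hP : IsPresentation L R)
    (Γ : L → (skeleton X).Walk x₀ x₀) (hΓ : ∀ g, loopClass (Γ g) = g) :
    ∃ δ > (0 : ℝ), ∃ C > (0 : ℝ),
      ∀ (A : Type u) [NonUnitalCStarAlgebra A] [PartialOrder A] [StarOrderedRing A]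
        (V : Type v) [NormedAddCommGroup V] [NormedSpace ℂ V] [CompleteSpace V] [SMul A V]
        [CStarModule A V],
      ∀ ε : ℝ, 0 < ε → ε ≤ δ →
      ∀ φ : FreeGroup L →* unitaryGroup A V, IsAlmostRep R ε φ →
      ∃ (E : HilbertModuleBundle.{u, v, u₀, v} A V (realization X)) (T : TrivializationFamily E),
        T.IsFlat (C * ε) ∧ IsAlmostRep R (C * ε) (T.transportRep Γ) ∧
        AreClose (C * ε) (T.transportRep Γ) φ := by
  have : Finite L := hL
  have : Finite R := hR
  obtain ⟨χ, hχ, hχl⟩ := exists_edgeClass (X := X) x₀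
  choose s hs using fun a b => hP.exists_lift_eq (χ a b)
  have hmono : ∀ {ε a : ℝ} {m n : ℕ}, 0 < ε → m ≤ n → a ≤ m * ε → a ≤ n * ε :=
    fun hε hmn h => h.trans (mul_le_mul_of_nonneg_right (by exact_mod_cast hmn) hε.le)
  -- Since χ is a cocycle, the two words represent the same element; finitely many triples of
  -- vertices allow a common N.
  obtain ⟨N₁, hN₁⟩ : ∃ N : ℕ, ∀ i : ι × ι × ι,
      ∀ (A : Type u) [NonUnitalCStarAlgebra A] [PartialOrder A] [StarOrderedRing A]
        (V : Type v) [NormedAddCommGroup V] [NormedSpace ℂ V] [SMul A V] [CStarModule A V]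
        (φ : FreeGroup L →* unitaryGroup A V) (ε : ℝ), 0 < ε → IsAlmostRep R ε φ →
        (∃ σ ∈ X.faces, i.1 ∈ σ ∧ i.2.1 ∈ σ ∧ i.2.2 ∈ σ) →
        ‖op (φ (s i.1 i.2.1 * s i.2.1 i.2.2)) - op (φ (s i.1 i.2.2))‖ ≤ N * ε := by
    refine exists_bound_of_finite (fun i m n hmn h A _ _ _ V _ _ _ _ φ ε hε hφ hi =>
      hmono hε hmn (h A V φ ε hε hφ hi)) fun ⟨a, b, c⟩ => ?_
    by_cases hi : ∃ σ ∈ X.faces, a ∈ σ ∧ b ∈ σ ∧ c ∈ σ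
    · obtain ⟨σ, hσ, ha, hb, hc⟩ := hi
      obtain ⟨N, hN⟩ := hP.exists_norm_sub_le (s := s a b * s b c) (t := s a c)
        (by rw [map_mul, hs, hs, hs, hχ σ hσ a ha b hb c hc])
      exact ⟨N, fun A _ _ _ V _ _ _ _ φ ε _ hφ _ => hN A V φ ε hφ⟩
    · exact ⟨0, fun A _ _ _ V _ _ _ _ φ ε _ hφ h => (hi h).elim⟩
  -- The product of the words along Γ g represents the class of Γ g, which is g.
  obtain ⟨N₂, hN₂⟩ : ∃ N : ℕ, ∀ g : L,
      ∀ (A : Type u) [NonUnitalCStarAlgebra A] [PartialOrder A] [StarOrderedRing A]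
        (V : Type v) [NormedAddCommGroup V] [NormedSpace ℂ V] [SMul A V] [CStarModule A V]
        (φ : FreeGroup L →* unitaryGroup A V) (ε : ℝ), 0 < ε → IsAlmostRep R ε φ →
        ‖op (φ (walkProd s (Γ g))) - op (φ (.of g))‖ ≤ N * ε := by
    refine exists_bound_of_finite (fun i m n hmn h A _ _ _ V _ _ _ _ φ ε hε hφ =>
      hmono hε hmn (h A V φ ε hε hφ)) fun g => ?_
    obtain ⟨N, hN⟩ := hP.exists_norm_sub_le (s := walkProd s (Γ g)) (t := .of g)
      (by rw [map_walkProd]; simp only [hs]; rw [hχl, hΓ, FreeGroup.lift_apply_of])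
    exact ⟨N, fun A _ _ _ V _ _ _ _ φ ε _ hφ => hN A V φ ε hφ⟩
  obtain ⟨N₃, hN₃⟩ : ∃ N : ℕ, ∀ r : R,
      ∀ (A : Type u) [NonUnitalCStarAlgebra A] [PartialOrder A] [StarOrderedRing A]
        (V : Type v) [NormedAddCommGroup V] [NormedSpace ℂ V] [SMul A V] [CStarModule A V]
        (φ ψ : FreeGroup L →* unitaryGroup A V) (δ : ℝ), 0 < δ →
        (∀ g, ‖op (φ (.of g)) - op (ψ (.of g))‖ ≤ δ) → ‖op (φ r) - op (ψ r)‖ ≤ N * δ := by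
    refine exists_bound_of_finite (fun i m n hmn h A _ _ _ V _ _ _ _ φ ψ ε hε hφ =>
      hmono hε hmn (h A V φ ψ ε hε hφ)) fun r => ?_
    obtain ⟨N, hN⟩ := exists_norm_freeGroup_sub_le r.1
    exact ⟨N, fun A _ _ _ V _ _ _ _ φ ψ ε _ hφ => hN A V φ ψ ε hφ⟩
  obtain ⟨N₄, hN₄⟩ : ∃ N : ℕ, ∀ g : L, (Γ g).length ≤ N :=
    exists_bound_of_finite (fun g m n hmn h => h.trans hmn) fun g => ⟨_, le_rfl⟩
  set c : ℝ := 200 ^ (Finset.univ : Finset ι).card with hc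
  have hc0 : 0 < c := by positivity
  set K : ℝ := c * (N₁ + 1) with hK
  have hK0 : 0 < K := by positivity
  set C₁ : ℝ := N₄ * (2 * K + 2 * (N₁ + 1)) + N₂ + 1 with hC₁
  have hC₁0 : 0 < C₁ := by positivity
  -- δ ensures K ε ≤ 1/5, as the interpolation requires. In C, the term K accounts for flatness, C₁
  -- for closeness to φ on generators, N₃ C₁ for the resulting change on relators, and 1 for the
  -- error ε of φ on the relators.
  refine ⟨1 / (5 * K), by positivity, K + C₁ + N₃ * C₁ + 1, by positivity, ?_⟩
  intro A _ _ _ V _ _ _ _ _ ε hε hεδ φ hφ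
  have hKε : K * ε ≤ 1 / 5 := by
    rw [le_div_iff₀ (by positivity)] at hεδ
    linarith
  have hu : IsAlmostCocycle X ((N₁ + 1) * ε) fun a b => φ (s a b) := fun σ hσ a ha b hb d hd => by
    rw [← map_mul φ]
    have := hN₁ (a, b, d) A V φ ε hε hφ ⟨σ, hσ, ha, hb, hd⟩
    exact this.trans (by linarith)
  obtain ⟨g, hg⟩ := hu.exists_isCocycleOn (by positivity) Finset.univ
    (by rw [← hc, ← mul_assoc]; exact hKε)
  rw [← hc, ← mul_assoc, ← hK] at hg
  have hclose : ∀ l : L, ‖op (hg.trivializationFamily.transportRep Γ (.of l)) -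
      op (φ (.of l))‖ ≤ C₁ * ε := fun l => by
    rw [TrivializationFamily.transportRep, FreeGroup.lift_apply_of,
      TrivializationFamily.loopTransport_eq]
    have h1 := norm_walkProd_sub_le (fun v w => hg.norm_edgeRep_sub_le hu (v := v) (w := w)) (Γ l)
    have h2 := hN₂ l A V φ ε hε hφ
    rw [map_walkProd] at h2
    have h3 : ((Γ l).length : ℝ) * (2 * (K * ε) + 2 * ((N₁ + 1) * ε)) ≤
        N₄ * (2 * (K * ε) + 2 * ((N₁ + 1) * ε)) :=
      mul_le_mul_of_nonneg_right (by exact_mod_cast hN₄ l) (by positivity)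
    have h4 := norm_sub_le_norm_sub_add_norm_sub
      (op (walkProd hg.trivializationFamily.edgeRep (Γ l)))
      (op (walkProd (fun a b => φ (s a b)) (Γ l))) (op (φ (.of l)))
    have h5 : C₁ * ε = N₄ * (2 * (K * ε) + 2 * ((N₁ + 1) * ε)) + N₂ * ε + ε := by rw [hC₁]; ring
    linarith
  have hN₃' : 0 ≤ N₃ * C₁ * ε := by positivity
  have hC₁' : 0 ≤ C₁ * ε := by positivity
  refine ⟨hg.bundle, hg.trivializationFamily, fun ρ σ h x y => ?_, fun r hr => ?_, fun l => ?_⟩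
  · refine (hg.isFlat ρ σ h x y).trans (mul_le_mul_of_nonneg_right ?_ dist_nonneg)
    nlinarith [hK0]
  · change ‖op (hg.trivializationFamily.transportRep Γ r) - op (1 : unitaryGroup A V)‖ < _
    have h1 := hN₃ ⟨r, hr⟩ A V _ φ (C₁ * ε) (by positivity) hclose
    have h2 : ‖op (φ r) - op (1 : unitaryGroup A V)‖ < ε := hφ r hr
    have h3 := norm_sub_le_norm_sub_add_norm_sub
      (op (hg.trivializationFamily.transportRep Γ r)) (op (φ r)) (op (1 : unitaryGroup A V))
    have h4 : 0 ≤ K * ε := by positivity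
    simp only at h1
    linarith
  · refine (hclose l).trans ?_
    have h4 : 0 ≤ K * ε := by positivity
    linarith

end Existence

end AlmostFlat


namespace AlmostFlat
set_option linter.unusedSectionVars false

open Bundle Topology Filter

/-! ### Frames over simplices in the local trivializations of a bundle. -/

section Coordinates

variable {ι : Type*} [Fintype ι] {X : AbstractSimplicialComplex ι}
  {A : Type*} [NonUnitalCStarAlgebra A] [PartialOrder A] [StarOrderedRing A]
  {V : Type*} [NormedAddCommGroup V] [NormedSpace ℂ V] [SMul A V] [CStarModule A V]

/-- The smallest simplex containing a point. -/
noncomputable def suppFace (x : realization X) : X.faces := ⟨supp x, supp_mem_faces x⟩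

theorem mem_cell_suppFace (x : realization X) : x ∈ cell X (suppFace x).1 := mem_cell_supp x

namespace TrivializationFamily

variable {E : HilbertModuleBundle A V (realization X)} (T : TrivializationFamily E)
  (e e₁ e₂ : Trivialization V (TotalSpace.proj : TotalSpace V E.Fiber → realization X))
  [MemTrivializationAtlas e] [MemTrivializationAtlas e₁] [MemTrivializationAtlas e₂]

open Classical in
/-- The frame `Φ_σ(x, ·)` in the coordinates of a local trivialization; `1` outside of the
domains. -/
noncomputable def coord (σ : X.faces) (x : realization X) : unitaryGroup A V :=
  if h : x ∈ cell X σ.1 ∧ x ∈ e.baseSet then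
    ⟨(T.Φ σ ⟨x, h.1⟩).trans (e.continuousLinearEquivAt ℂ x h.2),
      (T.isHilbertIso σ ⟨x, h.1⟩).trans (E.isHilbertIso e x h.2)⟩
  else 1

variable {e}

theorem coord_mul_frameChange {σ τ : X.faces} {x : realization X} (hx : x ∈ e.baseSet)
    (hσ : x ∈ cell X σ.1) (hτ : x ∈ cell X τ.1) :
    T.coord e σ x * T.frameChange σ τ x hσ hτ = T.coord e τ x := by
  rw [coord, coord, dif_pos ⟨hσ, hx⟩, dif_pos ⟨hτ, hx⟩]
  ext v
  exact congrArg (e.continuousLinearEquivAt ℂ x hx) ((T.Φ σ ⟨x, hσ⟩).apply_symm_apply _)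

theorem tendsto_coord {σ : X.faces} {x : realization X} (hx : x ∈ e.baseSet)
    (hσ : x ∈ cell X σ.1) :
    Tendsto (fun y => op (T.coord e σ y)) (𝓝[cell X σ.1] x) (𝓝 (op (T.coord e σ x))) := by
  rw [nhdsWithin_eq_map_subtype_coe hσ, tendsto_map'_iff]
  have hopen : {y : cell X σ.1 | y.1 ∈ e.baseSet} ∈ 𝓝 (⟨x, hσ⟩ : cell X σ.1) :=
    (e.open_baseSet.preimage continuous_subtype_val).mem_nhds hx
  have h := (T.continuousOn σ e).continuousAt hopen
  have heq : ∀ y : cell X σ.1, y.1 ∈ e.baseSet → (e.continuousLinearMapAt ℂ y.1).comp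
      (T.Φ σ y : V →L[ℂ] E.Fiber y.1) = op (T.coord e σ y.1) := fun y hy => by
    rw [coord, dif_pos ⟨y.2, hy⟩, ← e.coe_continuousLinearEquivAt_eq' hy]
    rfl
  have h1 := h.tendsto
  rw [heq ⟨x, hσ⟩ hx] at h1
  exact h1.congr' (Filter.eventually_of_mem hopen heq)

/-- The frame over the smallest simplex jumps with x, but it cancels in this product, leaving the
coordinate change from e₁ to e₂. -/
theorem continuousOn_coord_mul_inv :
    ContinuousOn (fun x => op (T.coord e₂ (suppFace x) x * (T.coord e₁ (suppFace x) x)⁻¹))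
      (e₁.baseSet ∩ e₂.baseSet) := by
  refine (continuousOn_coordChange ℂ e₁ e₂).congr fun x hx => ?_
  have h1 := mem_cell_suppFace x
  simp only [coord]
  rw [dif_pos ⟨h1, hx.2⟩, dif_pos ⟨h1, hx.1⟩]
  ext v
  change _ = (e₁.coordChangeL ℂ e₂ x) v
  rw [Trivialization.coordChangeL_apply _ _ hx]
  change (e₂.continuousLinearEquivAt ℂ x hx.2) (T.Φ (suppFace x) ⟨x, h1⟩
    ((T.Φ (suppFace x) ⟨x, h1⟩).symm ((e₁.continuousLinearEquivAt ℂ x hx.1).symm v))) = _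
  rw [ContinuousLinearEquiv.apply_symm_apply]
  rfl

end TrivializationFamily

end Coordinates

/-! ### Isomorphisms from approximate intertwiners, by averaging and polar decomposition. -/

section Isomorphism

variable {ι : Type*} [Fintype ι] {X : AbstractSimplicialComplex ι}
  {A : Type*} [NonUnitalCStarAlgebra A] [PartialOrder A] [StarOrderedRing A]
  {V : Type*} [NormedAddCommGroup V] [NormedSpace ℂ V] [SMul A V] [CStarModule A V]
  {E : HilbertModuleBundle A V (realization X)} {E' : HilbertModuleBundle A V (realization X)}

/-- The value at `x` of the section of unitaries which is constant in the preferred local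
trivializations at `p` and equals `d` at `p`. -/
noncomputable def localIso (T : TrivializationFamily E) (T' : TrivializationFamily E')
    (d : X.faces → unitaryGroup A V) (p x : realization X) : unitaryGroup A V :=
  (T'.coord (trivializationAt V E'.Fiber p) (suppFace x) x)⁻¹ *
    (T'.coord (trivializationAt V E'.Fiber p) (suppFace p) p * d (suppFace p) *
      (T.coord (trivializationAt V E.Fiber p) (suppFace p) p)⁻¹) *
    T.coord (trivializationAt V E.Fiber p) (suppFace x) x

theorem tendsto_op_inv {α : Type*} {l : Filter α} {f : α → unitaryGroup A V} {u : unitaryGroup A V}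
    (h : Tendsto (fun x => op (f x)) l (𝓝 (op u))) :
    Tendsto (fun x => op (f x)⁻¹) l (𝓝 (op u⁻¹)) := by
  rw [tendsto_iff_norm_sub_tendsto_zero] at h ⊢
  simpa only [norm_op_inv_sub] using h

theorem tendsto_op_mul {α : Type*} {l : Filter α} {f g : α → unitaryGroup A V}
    {u v : unitaryGroup A V} (h : Tendsto (fun x => op (f x)) l (𝓝 (op u)))
    (h' : Tendsto (fun x => op (g x)) l (𝓝 (op v))) :
    Tendsto (fun x => op (f x * g x)) l (𝓝 (op (u * v))) := by
  simp only [map_mul]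
  exact h.mul h'

/-- At p, in the frame of any σ containing `supp p`, the local section is d (suppFace p) conjugated
by frame changes, hence within 1/20 of d σ. Continuity along each of the finitely many σ keeps it
within 1/5 near p. -/
theorem eventually_norm_localIso_sub_le (T : TrivializationFamily E)
    (T' : TrivializationFamily E') (d : X.faces → unitaryGroup A V)
    (hd : ∀ (ρ σ : X.faces) (h : ρ.1 ⊆ σ.1) (x : realization X) (hx : x ∈ cell X ρ.1),
      ‖op (T'.frameChange ρ σ x hx (cell_mono h hx) * d σ) -
        op (d ρ * T.frameChange ρ σ x hx (cell_mono h hx))‖ ≤ 1 / 20) (p : realization X) :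
    ∀ᶠ x in 𝓝 p, ‖op (localIso T T' d p x) - op (d (suppFace x))‖ ≤ 1 / 5 := by
  set e := trivializationAt V E.Fiber p with he
  set e' := trivializationAt V E'.Fiber p with he'
  have hp : p ∈ e.baseSet := mem_baseSet_trivializationAt V E.Fiber p
  have hp' : p ∈ e'.baseSet := mem_baseSet_trivializationAt V E'.Fiber p
  have key : ∀ σ : X.faces, (suppFace p).1 ⊆ σ.1 → ∀ᶠ x in 𝓝 p, x ∈ cell X σ.1 →
      ‖op ((T'.coord e' σ x)⁻¹ * (T'.coord e' (suppFace p) p * d (suppFace p) *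
        (T.coord e (suppFace p) p)⁻¹) * T.coord e σ x) - op (d σ)‖ ≤ 1 / 5 := by
    intro σ hσ
    have hpσ : p ∈ cell X σ.1 := cell_mono hσ (mem_cell_suppFace p)
    have h1 := tendsto_op_mul (tendsto_op_mul (tendsto_op_inv (T'.tendsto_coord hp' hpσ))
      (tendsto_const_nhds (x := op (T'.coord e' (suppFace p) p * d (suppFace p) *
        (T.coord e (suppFace p) p)⁻¹)))) (T.tendsto_coord hp hpσ)
    have h2 := (h1.sub_const (op (d σ))).norm
    have h3 := hd (suppFace p) σ hσ p (mem_cell_suppFace p)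
    rw [← norm_op_mul_left_sub (T'.frameChange (suppFace p) σ p (mem_cell_suppFace p) hpσ)⁻¹,
      inv_mul_cancel_left, norm_sub_rev] at h3
    have h4 : (T'.coord e' σ p)⁻¹ * (T'.coord e' (suppFace p) p * d (suppFace p) *
        (T.coord e (suppFace p) p)⁻¹) * T.coord e σ p =
        (T'.frameChange (suppFace p) σ p (mem_cell_suppFace p) hpσ)⁻¹ *
          (d (suppFace p) * T.frameChange (suppFace p) σ p (mem_cell_suppFace p) hpσ) := by
      rw [← T.coord_mul_frameChange hp (mem_cell_suppFace p) hpσ,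
        ← T'.coord_mul_frameChange hp' (mem_cell_suppFace p) hpσ]
      group
    rw [h4] at h2
    have h5 := h2.eventually_le_const (u := 1 / 5) (lt_of_le_of_lt h3 (by norm_num))
    exact eventually_nhdsWithin_iff.1 h5
  have hfin : ∀ᶠ x in 𝓝 p, ∀ σ : X.faces, (suppFace p).1 ⊆ σ.1 → x ∈ cell X σ.1 →
      ‖op ((T'.coord e' σ x)⁻¹ * (T'.coord e' (suppFace p) p * d (suppFace p) *
        (T.coord e (suppFace p) p)⁻¹) * T.coord e σ x) - op (d σ)‖ ≤ 1 / 5 := by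
    have : Finite X.faces := Finite.of_injective (fun σ : X.faces => σ.1) Subtype.val_injective
    rw [eventually_all]
    intro σ
    by_cases h : (suppFace p).1 ⊆ σ.1
    · filter_upwards [key σ h] with x hx _ using hx
    · exact Eventually.of_forall fun x h' => (h h').elim
  filter_upwards [hfin, eventually_supp_subset p] with x hx hs
  exact hx (suppFace x) hs (mem_cell_suppFace x)

variable [CompleteSpace V]

theorem tendsto_op_polar {α : Type*} {l : Filter α} {f f' : α → V →L[ℂ] V} {a a' : V →L[ℂ] V}
    (hf : ∀ᶠ x in l, NearUnitary A (f x) (f' x)) (ha : NearUnitary A a a')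
    (h : Tendsto f l (𝓝 a)) (h' : Tendsto f' l (𝓝 a')) :
    Tendsto (fun x => op (polar (f x) (f' x) : unitaryGroup A V)) l
      (𝓝 (op (polar a a' : unitaryGroup A V))) := by
  rw [tendsto_iff_norm_sub_tendsto_zero] at h h' ⊢
  have h1 : Tendsto (fun x => 8 * ‖f x - a‖ + 6 * ‖f' x - a'‖) l (𝓝 0) := by
    simpa using (h.const_mul 8).add (h'.const_mul 6)
  refine squeeze_zero' (Eventually.of_forall fun _ => norm_nonneg _) ?_ h1
  filter_upwards [hf] with x hx using hx.norm_polar_sub_le ha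

/-- A weighted average of unitaries close to `w` is close to `w`. -/
theorem nearUnitary_sum {κ : Type*} {s : Finset κ} {t : κ → ℝ} (ht : ∀ i ∈ s, 0 ≤ t i)
    (hs : ∑ i ∈ s, t i = 1) {u : κ → unitaryGroup A V} {w : unitaryGroup A V}
    (hu : ∀ i ∈ s, ‖op (u i) - op w‖ ≤ 1 / 5) :
    NearUnitary A (∑ i ∈ s, t i • op (u i)) (∑ i ∈ s, t i • op (u i)⁻¹) := by
  have key : ∀ (u : κ → unitaryGroup A V) (w : unitaryGroup A V),
      (∀ i ∈ s, ‖op (u i) - op w‖ ≤ 1 / 5) → ‖∑ i ∈ s, t i • op (u i) - op w‖ ≤ 1 / 5 := by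
    intro u w hu
    have h1 : ∑ i ∈ s, t i • op (u i) - op w = ∑ i ∈ s, t i • (op (u i) - op w) := by
      simp only [smul_sub, Finset.sum_sub_distrib]
      rw [← Finset.sum_smul, hs, one_smul]
    rw [h1]
    calc _ ≤ ∑ i ∈ s, t i * (1 / 5) := by
          refine norm_sum_le_of_le _ fun i hi => ?_
          rw [norm_smul, Real.norm_of_nonneg (ht i hi)]
          exact mul_le_mul_of_nonneg_left (hu i hi) (ht i hi)
      _ = 1 / 5 := by rw [← Finset.sum_mul, hs, one_mul]
  exact ⟨IsAdj.sum s fun i _ => (isAdj_op _).smul _, w, key u w hu,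
    key _ w⁻¹ fun i hi => by rw [norm_op_inv_sub]; exact hu i hi⟩

/-- Two bundles are isomorphic if there are constant unitaries over the simplices which
approximately intertwine the changes of frames. -/
theorem isomorphic_of_intertwining (T : TrivializationFamily E)
    (T' : TrivializationFamily E') (d : X.faces → unitaryGroup A V)
    (hd : ∀ (ρ σ : X.faces) (h : ρ.1 ⊆ σ.1) (x : realization X) (hx : x ∈ cell X ρ.1),
      ‖op (T'.frameChange ρ σ x hx (cell_mono h hx) * d σ) -
        op (d ρ * T.frameChange ρ σ x hx (cell_mono h hx))‖ ≤ 1 / 20) : E.Isomorphic E' := by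
  have hU : ∀ p : realization X, ∃ U : Set (realization X), IsOpen U ∧ p ∈ U ∧
      U ⊆ (trivializationAt V E.Fiber p).baseSet ∧ U ⊆ (trivializationAt V E'.Fiber p).baseSet ∧
      ∀ x ∈ U, ‖op (localIso T T' d p x) - op (d (suppFace x))‖ ≤ 1 / 5 := by
    intro p
    obtain ⟨U, hU, hUo, hpU⟩ := eventually_nhds_iff.1 (eventually_norm_localIso_sub_le T T' d hd p)
    refine ⟨U ∩ ((trivializationAt V E.Fiber p).baseSet ∩
      (trivializationAt V E'.Fiber p).baseSet), ?_, ⟨hpU, ?_, ?_⟩, ?_, ?_, fun x hx => hU x hx.1⟩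
    · exact hUo.inter ((trivializationAt V E.Fiber p).open_baseSet.inter
        (trivializationAt V E'.Fiber p).open_baseSet)
    · exact mem_baseSet_trivializationAt V E.Fiber p
    · exact mem_baseSet_trivializationAt V E'.Fiber p
    · exact fun x hx => hx.2.1
    · exact fun x hx => hx.2.2
  choose U hUo hpU hUb hUb' hUn using hU
  obtain ⟨χ, hχ⟩ := PartitionOfUnity.exists_isSubordinate (s := Set.univ) isClosed_univ U hUo
    (fun p _ => Set.mem_iUnion.2 ⟨p, hpU p⟩)
  have hχU : ∀ x, ∀ i ∈ χ.finsupport x, x ∈ U i := fun x i hi =>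
    hχ i (subset_closure ((χ.mem_finsupport x).1 hi))
  -- The average is written in the jumping frames over `suppFace x`, where all its terms are within
  -- 1/5 of the one unitary d (suppFace x). Continuity is visible only after passing to bundle
  -- coordinates.
  let K : realization X → (V →L[ℂ] V) := fun x =>
    ∑ i ∈ χ.finsupport x, χ i x • op (localIso T T' d i x)
  let K' : realization X → (V →L[ℂ] V) := fun x =>
    ∑ i ∈ χ.finsupport x, χ i x • op (localIso T T' d i x)⁻¹
  have hnear : ∀ x, NearUnitary A (K x) (K' x) := fun x =>
    nearUnitary_sum (w := d (suppFace x)) (fun i _ => χ.nonneg i x)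
      (χ.sum_finsupport (Set.mem_univ x)) (fun i hi => hUn i x (hχU x i hi))
  let Ξ : ∀ x, E.Fiber x ≃L[ℂ] E'.Fiber x := fun x =>
    ((T.Φ (suppFace x) ⟨x, mem_cell_suppFace x⟩).symm.trans (polar (A := A) (K x) (K' x)).1).trans
      (T'.Φ (suppFace x) ⟨x, mem_cell_suppFace x⟩)
  refine ⟨Ξ, fun x => ((T.isHilbertIso _ _).symm.trans (polar (A := A) (K x) (K' x)).2).trans
    (T'.isHilbertIso _ _), ?_⟩
  intro e _ e' _ x hx
  refine ContinuousAt.continuousWithinAt ?_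
  let c : realization X → unitaryGroup A V := fun y => T.coord e (suppFace y) y
  let c' : realization X → unitaryGroup A V := fun y => T'.coord e' (suppFace y) y
  have hbase : e.baseSet ∩ e'.baseSet ∈ 𝓝 x :=
    (e.open_baseSet.inter e'.open_baseSet).mem_nhds hx
  -- Equivariance of `polar` lets the coordinates of e and e' be inserted before the unitary part is
  -- taken.
  have hcoord : ∀ y ∈ e.baseSet ∩ e'.baseSet, op (polar (A := A) (op (c' y) * K y * op (c y)⁻¹)
      (op (c y)⁻¹⁻¹ * K' y * op (c' y)⁻¹)) = (e'.continuousLinearMapAt ℂ y).comp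
        ((Ξ y : E.Fiber y →L[ℂ] E'.Fiber y).comp (e.symmL ℂ y)) := by
    intro y hy
    rw [(hnear y).polar_mul_op]
    simp only [c, c', TrivializationFamily.coord]
    rw [dif_pos ⟨mem_cell_suppFace y, hy.2⟩, dif_pos ⟨mem_cell_suppFace y, hy.1⟩,
      ← e'.coe_continuousLinearEquivAt_eq' hy.2, ← e.symm_continuousLinearEquivAt_eq' hy.1]
    rfl
  refine ContinuousAt.congr ?_ (Filter.eventually_of_mem hbase hcoord)
  have hterm : ∀ i ∈ χ.fintsupport x,
      Tendsto (fun y => op (c' y * localIso T T' d i y * (c y)⁻¹)) (𝓝 x)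
        (𝓝 (op (c' x * localIso T T' d i x * (c x)⁻¹))) := by
    intro i hi
    have hxi : x ∈ U i := hχ i ((χ.mem_fintsupport_iff x i).1 hi)
    have h1 := (T.continuousOn_coord_mul_inv (e₁ := e) (e₂ := trivializationAt V E.Fiber i)
      ).continuousAt ((e.open_baseSet.inter (trivializationAt V E.Fiber i).open_baseSet).mem_nhds
        ⟨hx.1, hUb i hxi⟩)
    have h2 := (T'.continuousOn_coord_mul_inv (e₁ := trivializationAt V E'.Fiber i) (e₂ := e')
      ).continuousAt (((trivializationAt V E'.Fiber i).open_baseSet.inter e'.open_baseSet).mem_nhds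
        ⟨hUb' i hxi, hx.2⟩)
    have h3 := tendsto_op_mul (tendsto_op_mul h2.tendsto (tendsto_const_nhds
      (x := op (T'.coord (trivializationAt V E'.Fiber i) (suppFace i) i * d (suppFace i) *
      (T.coord (trivializationAt V E.Fiber i) (suppFace i) i)⁻¹)))) h1.tendsto
    simpa only [localIso, mul_assoc] using h3
  -- Near x the sums can be taken over one fixed finite set, so that continuity follows term by
  -- term.
  have hsub : ∀ᶠ y in 𝓝 x, χ.finsupport y ⊆ χ.fintsupport x := χ.eventually_finsupport_subset x
  have hsum : ∀ y, χ.finsupport y ⊆ χ.fintsupport x → ∀ F : realization X → V →L[ℂ] V,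
      ∑ i ∈ χ.finsupport y, χ i y • F i = ∑ i ∈ χ.fintsupport x, χ i y • F i := fun y hy F =>
    Finset.sum_subset hy fun i _ hi => by
      have : χ i y = 0 := not_not.1 fun h => hi ((χ.mem_finsupport y).2 h)
      rw [this, zero_smul]
  have hK : Tendsto (fun y => op (c' y) * K y * op (c y)⁻¹) (𝓝 x)
      (𝓝 (op (c' x) * K x * op (c x)⁻¹)) := by
    have heq : ∀ y, χ.finsupport y ⊆ χ.fintsupport x → ∑ i ∈ χ.fintsupport x,
        χ i y • op (c' y * localIso T T' d i y * (c y)⁻¹) = op (c' y) * K y * op (c y)⁻¹ :=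
      fun y hy => by
        simp only [K]
        rw [hsum y hy, Finset.mul_sum, Finset.sum_mul]
        refine Finset.sum_congr rfl fun i _ => ?_
        rw [mul_smul_comm, smul_mul_assoc, map_mul, map_mul]
    rw [← heq x (χ.finsupport_subset_fintsupport x)]
    refine Tendsto.congr' (Filter.Eventually.mono hsub heq) ?_
    exact tendsto_finsetSum _ fun i hi => ((χ i).continuous.tendsto x).smul (hterm i hi)
  have hK' : Tendsto (fun y => op (c y)⁻¹⁻¹ * K' y * op (c' y)⁻¹) (𝓝 x)
      (𝓝 (op (c x)⁻¹⁻¹ * K' x * op (c' x)⁻¹)) := by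
    have heq : ∀ y, χ.finsupport y ⊆ χ.fintsupport x → ∑ i ∈ χ.fintsupport x,
        χ i y • op (c' y * localIso T T' d i y * (c y)⁻¹)⁻¹ =
          op (c y)⁻¹⁻¹ * K' y * op (c' y)⁻¹ :=
      fun y hy => by
        simp only [K']
        rw [hsum y hy, Finset.mul_sum, Finset.sum_mul]
        refine Finset.sum_congr rfl fun i _ => ?_
        rw [mul_smul_comm, smul_mul_assoc, mul_inv_rev, mul_inv_rev, map_mul, map_mul, mul_assoc]
    rw [← heq x (χ.finsupport_subset_fintsupport x)]
    refine Tendsto.congr' (Filter.Eventually.mono hsub heq) ?_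
    exact tendsto_finsetSum _ fun i hi =>
      ((χ i).continuous.tendsto x).smul (tendsto_op_inv (hterm i hi))
  exact tendsto_op_polar (Eventually.of_forall fun y => (hnear y).mul_op (c' y) (c y)⁻¹)
    ((hnear x).mul_op (c' x) (c x)⁻¹) hK hK'

end Isomorphism

end AlmostFlat


namespace AlmostFlat
set_option linter.unusedSectionVars false


/-! ### The universal cocycle and transport along arbitrary loops. -/

section EdgeRelations

variable {ι : Type*} [Fintype ι] [DecidableEq ι] (X : AbstractSimplicialComplex ι)

/-- The relations `(a, b) (b, c) = (a, c)` for the vertices of a common simplex. -/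
def triangleRelators : Set (FreeGroup (ι × ι)) :=
  {r | ∃ σ ∈ X.faces, ∃ a ∈ σ, ∃ b ∈ σ, ∃ c ∈ σ,
    r = .of (a, b) * .of (b, c) * (.of (a, c))⁻¹}

theorem isCocycle_mk_triangleRelators : IsCocycle X fun a b =>
    (QuotientGroup.mk' (Subgroup.normalClosure (triangleRelators X)) (.of (a, b))) := by
  intro σ hσ a ha b hb c hc
  rw [← map_mul, ← mul_inv_eq_one, ← map_inv, ← map_mul]
  exact (QuotientGroup.eq_one_iff _).2 (Subgroup.subset_normalClosure
    ⟨σ, hσ, a, ha, b, hb, c, hc, rfl⟩)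

variable {X}

/-- The product of an almost cocycle along a loop is determined, up to a bounded error, by its
products along loops which generate the fundamental group. -/
theorem exists_norm_walkProd_sub_lift_le {x₀ : ι} {L : Type*} (Γ : L → (skeleton X).Walk x₀ x₀)
    (l : (skeleton X).Walk x₀ x₀) {s : FreeGroup L}
    (hs : FreeGroup.lift (fun g => loopClass (Γ g)) s = loopClass l) :
    ∃ N : ℕ, ∀ (A : Type u) [NonUnitalCStarAlgebra A] [PartialOrder A] [StarOrderedRing A]
        (V : Type v) [NormedAddCommGroup V] [NormedSpace ℂ V] [SMul A V] [CStarModule A V]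
        (t : ι → ι → unitaryGroup A V) (ε : ℝ), IsAlmostCocycle X ε t →
        ‖op (walkProd t l) - op (FreeGroup.lift (fun g => walkProd t (Γ g)) s)‖ ≤ N * ε := by
  have hf := isCocycle_mk_triangleRelators X
  set q := QuotientGroup.mk' (Subgroup.normalClosure (triangleRelators X)) with hq
  let o : ι → ι → FreeGroup (ι × ι) := fun a b => .of (a, b)
  obtain ⟨γ, hγ, hγ'⟩ := exists_walk_of_word hf Γ s
  -- In the group generated by the edges subject to the triangle relations, the word and the loop
  -- have equal products; so their discrepancy in the free group lies in the normal closure of the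
  -- triangle relators.
  have h1 := hf.walkProd_eq (hγ.trans hs)
  have h2 : (FreeGroup.lift fun g => walkProd (fun a b => q (.of (a, b))) (Γ g)) =
      q.comp (FreeGroup.lift fun g => walkProd o (Γ g)) := by
    ext g
    simp [map_walkProd, o]
  rw [hγ', h2, ← map_walkProd q o l, MonoidHom.comp_apply] at h1
  have hn : walkProd o l * (FreeGroup.lift (fun g => walkProd o (Γ g)) s)⁻¹ ∈
      Subgroup.normalClosure (triangleRelators X) := by
    rw [← QuotientGroup.eq_one_iff]
    change q _ = 1
    rw [map_mul, map_inv, h1, mul_inv_cancel]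
  obtain ⟨N, hN⟩ := exists_norm_op_sub_one_le hn
  refine ⟨N, fun A _ _ _ V _ _ _ _ t ε ht => ?_⟩
  -- An almost cocycle is exactly a homomorphism that moves each triangle relator to within ε of 1.
  let θ : FreeGroup (ι × ι) →* unitaryGroup A V := FreeGroup.lift fun i => t i.1 i.2
  have hθ : ∀ {v w : ι} (p : (skeleton X).Walk v w), θ (walkProd o p) = walkProd t p := fun p => by
    rw [map_walkProd]
    simp [θ, o]
  have hθs : θ (FreeGroup.lift (fun g => walkProd o (Γ g)) s) =
      FreeGroup.lift (fun g => walkProd t (Γ g)) s := by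
    have : θ.comp (FreeGroup.lift fun g => walkProd o (Γ g)) =
        FreeGroup.lift fun g => walkProd t (Γ g) := by
      ext1 g
      simp [hθ]
    exact DFunLike.congr_fun this s
  have h3 := hN A V θ ε (by
    rintro r ⟨σ, hσ, a, ha, b, hb, c, hc, rfl⟩
    have h4 := ht σ hσ a ha b hb c hc
    rw [← norm_op_mul_right_sub (t a c)⁻¹, mul_inv_cancel, map_one] at h4
    simpa [θ] using h4)
  rw [map_mul θ, map_inv θ, hθ, hθs] at h3
  rwa [← norm_op_mul_right_sub (FreeGroup.lift (fun g => walkProd t (Γ g)) s)⁻¹, mul_inv_cancel,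
    map_one]

end EdgeRelations

/-! ### Edge transports of an almost flat bundle. -/

section FlatBundles

variable {ι : Type*} [Fintype ι] [DecidableEq ι] {X : AbstractSimplicialComplex ι}
  {A : Type*} [NonUnitalCStarAlgebra A] [PartialOrder A] [StarOrderedRing A]
  {V : Type*} [NormedAddCommGroup V] [NormedSpace ℂ V] [SMul A V] [CStarModule A V]

theorem dist_realization_le_two (x y : realization X) : dist x y ≤ 2 := by
  rw [Subtype.dist_eq, dist_eq_norm]
  exact (norm_sub_le _ _).trans (by linarith [norm_realization_le_one x, norm_realization_le_one y])

namespace TrivializationFamily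

variable {E : HilbertModuleBundle A V (realization X)} (T : TrivializationFamily E)

theorem transportRep_eq {L : Type*} {x₀ : ι} (Γ : L → (skeleton X).Walk x₀ x₀) :
    T.transportRep Γ = FreeGroup.lift fun g => walkProd T.edgeRep (Γ g) := by
  rw [transportRep]
  simp only [loopTransport_eq]

theorem mem_cell_vertexFace (v : ι) : vertex X v ∈ cell X (vertexFace X v).1 :=
  vertex_mem_cell (by simp [vertexFace])

theorem edgeRep_eq {v w : ι} (h : (skeleton X).Adj v w) (e : X.faces) (he : e.1 = {v, w})
    (hv : vertex X v ∈ cell X e.1) (hw : vertex X w ∈ cell X e.1) :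
    T.edgeRep w v = T.frameChange (vertexFace X w) e (vertex X w) (mem_cell_vertexFace w) hw *
      T.frameChange e (vertexFace X v) (vertex X v) hv (mem_cell_vertexFace v) := by
  obtain rfl : e = ⟨{v, w}, h.2⟩ := Subtype.ext he
  rw [edgeRep, dif_pos h]

theorem edgeRep_self (v : ι) : T.edgeRep v v = 1 := by
  rw [edgeRep, dif_neg (SimpleGraph.irrefl _)]

theorem edgeRep_mul_swap {v w : ι} (h : (skeleton X).Adj v w) :
    T.edgeRep v w * T.edgeRep w v = 1 := by
  have hv : vertex X v ∈ cell X {v, w} := vertex_mem_cell (by simp)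
  have hw : vertex X w ∈ cell X {v, w} := vertex_mem_cell (by simp)
  rw [T.edgeRep_eq h ⟨{v, w}, h.2⟩ rfl hv hw,
    T.edgeRep_eq h.symm ⟨{v, w}, h.2⟩ (Finset.pair_comm v w) hw hv, mul_assoc,
    ← mul_assoc (T.frameChange _ (vertexFace X w) _ _ _), frameChange_mul, frameChange_self,
    one_mul, frameChange_mul, frameChange_self]

/-- Transport from `v` to `w` inside a simplex containing both of them. -/
noncomputable def faceRep (σ : X.faces) (w v : ι) (hw : w ∈ σ.1) (hv : v ∈ σ.1) :
    unitaryGroup A V :=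
  T.frameChange (vertexFace X w) σ (vertex X w) (mem_cell_vertexFace w) (vertex_mem_cell hw) *
    T.frameChange σ (vertexFace X v) (vertex X v) (vertex_mem_cell hv) (mem_cell_vertexFace v)

theorem faceRep_mul (σ : X.faces) (a b c : ι) (ha : a ∈ σ.1) (hb : b ∈ σ.1) (hc : c ∈ σ.1) :
    T.faceRep σ a b ha hb * T.faceRep σ b c hb hc = T.faceRep σ a c ha hc := by
  rw [faceRep, faceRep, faceRep, mul_assoc, ← mul_assoc (T.frameChange σ (vertexFace X b) _ _ _),
    frameChange_mul, frameChange_self, one_mul]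

variable {T} {δ : ℝ}

theorem IsFlat.norm_frameChange_sub_le_two_mul (hT : T.IsFlat δ) (hδ : 0 ≤ δ) {ρ σ : X.faces}
    (hρσ : ρ.1 ⊆ σ.1) {x y : realization X} (hx : x ∈ cell X ρ.1) (hy : y ∈ cell X ρ.1) :
    ‖op (T.frameChange ρ σ x hx (cell_mono hρσ hx)) -
      op (T.frameChange ρ σ y hy (cell_mono hρσ hy))‖ ≤ 2 * δ :=
  (hT.norm_frameChange_sub_le hρσ hx hy).trans (by
    linarith [mul_le_mul_of_nonneg_left (dist_realization_le_two x y) hδ])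

/-- Replacing the frame of the edge by that of σ inserts the transition function at w times its
inverse at v, two values differing by at most 2 δ. -/
theorem IsFlat.norm_edgeRep_sub_faceRep_le (hT : T.IsFlat δ) (hδ : 0 ≤ δ) (σ : X.faces) {v w : ι}
    (hw : w ∈ σ.1) (hv : v ∈ σ.1) :
    ‖op (T.edgeRep w v) - op (T.faceRep σ w v hw hv)‖ ≤ 2 * δ := by
  rcases adj_or_eq_of_mem_faces σ.2 hv hw with rfl | h
  · rw [edgeRep_self, faceRep, frameChange_mul, frameChange_self, sub_self, norm_zero]
    positivity
  · have hve : vertex X v ∈ cell X {v, w} := vertex_mem_cell (by simp)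
    have hwe : vertex X w ∈ cell X {v, w} := vertex_mem_cell (by simp)
    have hs : (⟨{v, w}, h.2⟩ : X.faces).1 ⊆ σ.1 := by simp [Finset.insert_subset_iff, hv, hw]
    have h1 := hT.norm_frameChange_sub_le_two_mul hδ hs hve hwe
    rw [T.edgeRep_eq h ⟨{v, w}, h.2⟩ rfl hve hwe, faceRep,
      ← T.frameChange_mul _ ⟨{v, w}, h.2⟩ σ (vertex X w) _ hwe _,
      ← T.frameChange_mul σ ⟨{v, w}, h.2⟩ _ (vertex X v) _ hve _, mul_assoc,
      norm_op_mul_left_sub, ← mul_assoc]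
    rw [← norm_op_mul_right_sub
      (T.frameChange σ ⟨{v, w}, h.2⟩ (vertex X v) (cell_mono hs hve) hve),
      frameChange_mul, frameChange_self] at h1
    have h2 := norm_op_mul_right_sub (T.frameChange ⟨{v, w}, h.2⟩ (vertexFace X v) (vertex X v)
      hve (mem_cell_vertexFace v)) 1
      (T.frameChange ⟨{v, w}, h.2⟩ σ (vertex X w) hwe (cell_mono hs hwe) *
        T.frameChange σ ⟨{v, w}, h.2⟩ (vertex X v) (cell_mono hs hve) hve)
    rw [one_mul] at h2
    exact h2.trans_le h1

/-- Within the frame of a single simplex, `faceRep` is an exact cocycle; three replacements at 2 δ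
each give 6 δ. -/
theorem IsFlat.isAlmostCocycle_edgeRep (hT : T.IsFlat δ) (hδ : 0 ≤ δ) :
    IsAlmostCocycle X (6 * δ) T.edgeRep := by
  intro σ hσ a ha b hb c hc
  have h1 := hT.norm_edgeRep_sub_faceRep_le hδ ⟨σ, hσ⟩ ha hb
  have h2 := hT.norm_edgeRep_sub_faceRep_le hδ ⟨σ, hσ⟩ hb hc
  have h3 := hT.norm_edgeRep_sub_faceRep_le hδ ⟨σ, hσ⟩ ha hc
  have h4 := norm_op_mul_sub_le (T.edgeRep a b) (T.edgeRep b c) (T.faceRep ⟨σ, hσ⟩ a b ha hb)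
    (T.faceRep ⟨σ, hσ⟩ b c hb hc)
  rw [faceRep_mul] at h4
  have h5 := norm_sub_le_norm_sub_add_norm_sub (op (T.edgeRep a b * T.edgeRep b c))
    (op (T.faceRep ⟨σ, hσ⟩ a c ha hc)) (op (T.edgeRep a c))
  rw [norm_sub_rev] at h3
  linarith

end TrivializationFamily

open TrivializationFamily

/-- Two flat bundles are isomorphic if unitaries between the fibres at the vertices approximately
intertwine the transports along the edges. -/
theorem isomorphic_of_edgeRep_intertwining [CompleteSpace V]
    {E : HilbertModuleBundle.{_, _, _, w} A V (realization X)}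
    {E' : HilbertModuleBundle.{_, _, _, w₁} A V (realization X)} {T : TrivializationFamily E}
    {T' : TrivializationFamily E'} {δ M : ℝ} (hδ : 0 ≤ δ) (hT : T.IsFlat δ) (hT' : T'.IsFlat δ)
    (κ : ι → unitaryGroup A V)
    (hκ : ∀ σ ∈ X.faces, ∀ v ∈ σ, ∀ w ∈ σ,
      ‖op (T'.edgeRep w v * κ v) - op (κ w * T.edgeRep w v)‖ ≤ M * δ)
    (hM : (M + 8) * δ ≤ 1 / 20) : E.Isomorphic E' := by
  -- κ v, rewritten in the frames of σ; a change of the vertex v alters it by at most (M + 4) δ.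
  let d' : ∀ (σ : X.faces) (v : ι), v ∈ σ.1 → unitaryGroup A V := fun σ v hv =>
    T'.frameChange σ (vertexFace X v) (vertex X v) (vertex_mem_cell hv) (mem_cell_vertexFace v) *
      κ v *
      T.frameChange (vertexFace X v) σ (vertex X v) (mem_cell_vertexFace v) (vertex_mem_cell hv)
  have hd' : ∀ (σ : X.faces) (v w : ι) (hv : v ∈ σ.1) (hw : w ∈ σ.1),
      ‖op (d' σ v hv) - op (d' σ w hw)‖ ≤ (M + 4) * δ := by
    intro σ v w hv hw
    have h1 := hT.norm_edgeRep_sub_faceRep_le hδ σ hw hv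
    have h2 := hT'.norm_edgeRep_sub_faceRep_le hδ σ hw hv
    have h3 := hκ σ.1 σ.2 v hv w hw
    rw [← norm_op_mul_right_sub (κ v), norm_sub_rev] at h2
    rw [← norm_op_mul_left_sub (κ w)] at h1
    have h4 : ‖op (T'.faceRep σ w v hw hv * κ v) - op (κ w * T.faceRep σ w v hw hv)‖ ≤
        (M + 4) * δ := by
      have h5 := norm_sub_le_norm_sub_add_norm_sub (op (T'.faceRep σ w v hw hv * κ v))
        (op (T'.edgeRep w v * κ v)) (op (κ w * T.edgeRep w v))
      have h6 := norm_sub_le_norm_sub_add_norm_sub (op (T'.faceRep σ w v hw hv * κ v))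
        (op (κ w * T.edgeRep w v)) (op (κ w * T.faceRep σ w v hw hv))
      linarith
    rw [← norm_op_mul_left_sub (T'.frameChange (vertexFace X w) σ (vertex X w)
      (mem_cell_vertexFace w) (vertex_mem_cell hw)),
      ← norm_op_mul_right_sub (T.frameChange σ (vertexFace X v) (vertex X v)
        (vertex_mem_cell hv) (mem_cell_vertexFace v))]
    convert h4 using 4
    · simp only [d', faceRep, mul_assoc]
      rw [frameChange_mul, frameChange_self, mul_one]
    · simp only [d', faceRep]
      rw [← mul_assoc, ← mul_assoc, frameChange_mul, frameChange_self, one_mul, mul_assoc]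
  refine isomorphic_of_intertwining T T' (fun σ => d' σ (faceVertex σ) (faceVertex_mem σ))
    fun ρ σ h x hx => ?_
  set v := faceVertex ρ
  have hv : v ∈ ρ.1 := faceVertex_mem ρ
  have hvρ : vertex X v ∈ cell X ρ.1 := vertex_mem_cell hv
  have h1 := hT.norm_frameChange_sub_le_two_mul hδ h hx hvρ
  have h2 := hT'.norm_frameChange_sub_le_two_mul hδ h hx hvρ
  have h3 := hd' σ (faceVertex σ) v (faceVertex_mem σ) (h hv)
  -- At the vertex v itself the intertwining is exact. Moving from v to x costs 2 δ in each bundle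
  -- and changing the vertex used for σ costs (M + 4) δ, in total (M + 8) δ.
  have h4 : T'.frameChange ρ σ (vertex X v) hvρ (cell_mono h hvρ) * d' σ v (h hv) =
      d' ρ v hv * T.frameChange ρ σ (vertex X v) hvρ (cell_mono h hvρ) := by
    simp only [d', ← mul_assoc]
    rw [frameChange_mul]
    simp only [mul_assoc]
    rw [frameChange_mul]
  have h5 := norm_op_mul_sub_le (T'.frameChange ρ σ x hx (cell_mono h hx))
    (d' σ (faceVertex σ) (faceVertex_mem σ))
    (T'.frameChange ρ σ (vertex X v) hvρ (cell_mono h hvρ)) (d' σ v (h hv))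
  rw [h4] at h5
  rw [norm_sub_rev, ← norm_op_mul_left_sub (d' ρ v hv)] at h1
  refine (norm_sub_le_norm_sub_add_norm_sub _ _ _).trans ((add_le_add h5 h1).trans ?_)
  linarith

end FlatBundles

/-! ### Nearby holonomies force isomorphism. -/

section Uniqueness

open TrivializationFamily

variable {ι : Type*} [Fintype ι] [DecidableEq ι] {X : AbstractSimplicialComplex ι} {x₀ : ι}

/-- Almost flat bundles over a connected complex with nearby holonomies are isomorphic. -/
theorem exists_isomorphic_of_areClose
    {L : Set (FundamentalGroup (realization X) (vertex X x₀))}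
    {R : Set (FreeGroup L)} (hP : IsPresentation L R)
    (Γ : L → (skeleton X).Walk x₀ x₀) (hΓ : ∀ g, loopClass (Γ g) = g)
    (hX : (skeleton X).Connected)
    (Γ' : L → (skeleton X).Walk x₀ x₀) (hΓ' : ∀ g, loopClass (Γ' g) = g) :
      ∃ δ > (0 : ℝ),
      ∀ (A : Type u) [NonUnitalCStarAlgebra A] [PartialOrder A] [StarOrderedRing A]
        (V : Type v) [NormedAddCommGroup V] [NormedSpace ℂ V] [CompleteSpace V] [SMul A V]
        [CStarModule A V],
      ∀ (E : HilbertModuleBundle.{u, v, _, w} A V (realization X)) (T : TrivializationFamily E)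
        (E' : HilbertModuleBundle.{u, v, _, w₁} A V (realization X))
        (T' : TrivializationFamily E'),
        T.IsFlat δ → T'.IsFlat δ → AreClose δ (T.transportRep Γ) (T'.transportRep Γ') →
        E.Isomorphic E' := by
  let p : ∀ v, (skeleton X).Walk x₀ v := fun v => (hX.preconnected x₀ v).some
  obtain ⟨N, hN⟩ : ∃ N : ℕ, ∀ i : ι × ι,
      ∀ (A : Type u) [NonUnitalCStarAlgebra A] [PartialOrder A] [StarOrderedRing A]
        (V : Type v) [NormedAddCommGroup V] [NormedSpace ℂ V] [SMul A V] [CStarModule A V]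
        (t t' : ι → ι → unitaryGroup A V) (ε : ℝ), 0 ≤ ε → IsAlmostCocycle X ε t →
        IsAlmostCocycle X ε t' →
        (∀ v w, (skeleton X).Adj v w → t v w * t w v = 1) →
        (∀ v w, (skeleton X).Adj v w → t' v w * t' w v = 1) →
        (∀ g : L, ‖op (walkProd t (Γ g)) - op (walkProd t' (Γ' g))‖ ≤ ε) →
        (skeleton X).Adj i.1 i.2 →
        ‖op ((walkProd t (p i.2))⁻¹ * t i.2 i.1 * walkProd t (p i.1)) -
          op ((walkProd t' (p i.2))⁻¹ * t' i.2 i.1 * walkProd t' (p i.1))‖ ≤ N * ε := by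
    refine exists_bound_of_finite (fun i m n hmn H A _ _ _ V _ _ _ _ t t' ε hε h1 h2 h3 h4 h5 h6 =>
      (H A V t t' ε hε h1 h2 h3 h4 h5 h6).trans
        (mul_le_mul_of_nonneg_right (by exact_mod_cast hmn) hε)) fun ⟨v, w⟩ => ?_
    by_cases hvw : (skeleton X).Adj v w
    · let l : (skeleton X).Walk x₀ x₀ := (p v).append (.cons hvw (p w).reverse)
      obtain ⟨s, hs⟩ := hP.exists_lift_eq (loopClass l)
      obtain ⟨N₁, hN₁⟩ := exists_norm_walkProd_sub_lift_le Γ l (s := s) (by simp only [hΓ, hs])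
      obtain ⟨N₂, hN₂⟩ := exists_norm_walkProd_sub_lift_le Γ' l (s := s) (by simp only [hΓ', hs])
      obtain ⟨N₃, hN₃⟩ := exists_norm_freeGroup_sub_le s
      refine ⟨N₁ + N₂ + N₃, fun A _ _ _ V _ _ _ _ t t' ε hε h1 h2 h3 h4 h5 _ => ?_⟩
      have hl : ∀ t : ι → ι → unitaryGroup A V,
          (∀ v w, (skeleton X).Adj v w → t v w * t w v = 1) →
          (walkProd t (p w))⁻¹ * t w v * walkProd t (p v) = walkProd t l := fun t ht => by
        rw [walkProd_append, walkProd_cons, walkProd_reverse t ht]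
      simp only
      rw [hl t h3, hl t' h4]
      have h6 := hN₁ A V t ε h1
      have h7 := hN₂ A V t' ε h2
      have h8 := hN₃ A V (FreeGroup.lift fun g => walkProd t (Γ g))
        (FreeGroup.lift fun g => walkProd t' (Γ' g)) ε (by
          intro g
          rw [FreeGroup.lift_apply_of, FreeGroup.lift_apply_of]
          exact h5 g)
      rw [norm_sub_rev] at h7
      have h9 := norm_sub_le_norm_sub_add_norm_sub (op (walkProd t l))
        (op (FreeGroup.lift (fun g => walkProd t (Γ g)) s)) (op (walkProd t' l))
      have h10 := norm_sub_le_norm_sub_add_norm_sub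
        (op (FreeGroup.lift (fun g => walkProd t (Γ g)) s))
        (op (FreeGroup.lift (fun g => walkProd t' (Γ' g)) s)) (op (walkProd t' l))
      push_cast
      linarith
    · exact ⟨0, fun A _ _ _ V _ _ _ _ t t' ε _ _ _ _ _ _ h => (hvw h).elim⟩
  refine ⟨1 / (20 * (6 * N + 8)), by positivity, ?_⟩
  set δ : ℝ := 1 / (20 * (6 * N + 8)) with hδ_def
  have hδ : 0 ≤ δ := by positivity
  intro A _ _ _ V _ _ _ _ _ E T E' T' hT hT' hclose
  -- κ v goes back to x₀ in E and out to v in E'. Multiplying by the transports along the chosen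
  -- paths turns its intertwining defect on an edge into the difference of the two loop transports.
  -- M = 6 N because the edge transports are 6 δ-almost cocycles.
  refine isomorphic_of_edgeRep_intertwining (M := 6 * N) hδ hT hT'
    (fun v => walkProd T'.edgeRep (p v) * (walkProd T.edgeRep (p v))⁻¹) ?_ ?_
  · intro σ hσ v hv w hw
    rcases adj_or_eq_of_mem_faces hσ hv hw with rfl | hvw
    · rw [edgeRep_self, edgeRep_self, one_mul, mul_one, sub_self, norm_zero]
      positivity
    · have h1 := hN (v, w) A V T.edgeRep T'.edgeRep (6 * δ) (by positivity)
        (hT.isAlmostCocycle_edgeRep hδ) (hT'.isAlmostCocycle_edgeRep hδ)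
        (fun _ _ => T.edgeRep_mul_swap) (fun _ _ => T'.edgeRep_mul_swap) (fun g => by
          have := hclose g
          rw [transportRep_eq, transportRep_eq, FreeGroup.lift_apply_of,
            FreeGroup.lift_apply_of] at this
          exact le_trans this (by linarith)) hvw
      rw [← norm_op_mul_left_sub (walkProd T'.edgeRep (p w)),
        ← norm_op_mul_right_sub (walkProd T.edgeRep (p v))⁻¹, norm_sub_rev] at h1
      simp only [mul_assoc, mul_inv_cancel, mul_one, mul_inv_cancel_left] at h1 ⊢
      linarith
  · rw [hδ_def]
    apply le_of_eq
    field_simp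

end Uniqueness

end AlmostFlat


theorem mainTheorem12 {ι : Type u₀} [Fintype ι] [DecidableEq ι]
    (X : AbstractSimplicialComplex ι) (x₀ : ι)
    (L : Set (FundamentalGroup (realization X) (vertex X x₀))) (hL : L.Finite)
    (R : Set (FreeGroup L)) (hR : R.Finite) (hP : IsPresentation L R)
    (Γ : L → (skeleton X).Walk x₀ x₀) (hΓ : ∀ g, loopClass (Γ g) = g) :
    (∃ δ > (0 : ℝ), ∃ C > (0 : ℝ),
      ∀ (A : Type u) [NonUnitalCStarAlgebra A] [PartialOrder A] [StarOrderedRing A]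
        (V : Type v) [NormedAddCommGroup V] [NormedSpace ℂ V] [CompleteSpace V] [SMul A V]
        [CStarModule A V], IsFGProjective A V →
      ∀ ε : ℝ, 0 < ε → ε ≤ δ →
      ∀ φ : FreeGroup L →* unitaryGroup A V, IsAlmostRep R ε φ →
      ∃ (E : HilbertModuleBundle.{u, v, u₀, v} A V (realization X)) (T : TrivializationFamily E),
        T.IsFlat (C * ε) ∧ IsAlmostRep R (C * ε) (T.transportRep Γ) ∧
        AreClose (C * ε) (T.transportRep Γ) φ) ∧
    ((skeleton X).Connected →
      ∀ Γ' : L → (skeleton X).Walk x₀ x₀, (∀ g, loopClass (Γ' g) = g) →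
      ∃ δ > (0 : ℝ),
      ∀ (A : Type u) [NonUnitalCStarAlgebra A] [PartialOrder A] [StarOrderedRing A]
        (V : Type v) [NormedAddCommGroup V] [NormedSpace ℂ V] [CompleteSpace V] [SMul A V]
        [CStarModule A V], IsFGProjective A V →
      ∀ (E : HilbertModuleBundle.{u, v, u₀, w} A V (realization X)) (T : TrivializationFamily E)
        (E' : HilbertModuleBundle.{u, v, u₀, w₁} A V (realization X))
        (T' : TrivializationFamily E'),
        T.IsFlat δ → T'.IsFlat δ → AreClose δ (T.transportRep Γ) (T'.transportRep Γ') →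
        E.Isomorphic E') := by
  refine ⟨?_, ?_⟩
  · obtain ⟨δ, hδ, C, hC, h⟩ := exists_almostFlat_bundle hL hR hP Γ hΓ
    exact ⟨δ, hδ, C, hC, fun A _ _ _ V _ _ _ _ _ _ => h A V⟩
  · intro hX Γ' hΓ'
    obtain ⟨δ, hδ, h⟩ := exists_isomorphic_of_areClose hP Γ hΓ hX Γ' hΓ'
    exact ⟨δ, hδ, fun A _ _ _ V _ _ _ _ _ _ => h A V⟩
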